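/- Let $(M_1,g_1)$ be a Riemannian manifold, let $(M_2(c),g_2)$ be a Riemannian manifold of constant sectional curvature $c$, that is, with curvature tensor $R(X,Y)Z=c\{g_2(Y,Z)X-g_2(X,Z)Y\}$, and let $F:M_1\to M_2(c)$ be a Riemannian map: $F$ is smooth and $g_2(F_*X,F_*Y)=g_1(X,Y)$ for all $X,Y\in(\ker F_*)^\perp$. Notation. Let $\nabla$ be the Levi-Civita connection of $M_1$ and $\nabla^F$ the pullback to $F^{-1}TM_2$ of the Levi-Civita connection of $M_2$. Put $(\nabla F_*)(X,Y)=\nabla^F_XF_*Y-F_*(\nabla_XY)$, $\tau(F)=\operatorname{trace}\nabla F_*$, and call $F$ biharmonic if its bitension field $-\Delta^F\tau(F)-\operatorname{trace}R(F_*(\cdot),\tau(F))F_*(\cdot)$ vanishes, where $\Delta^F=-\operatorname{trace}(\nabla^F\nabla^F-\nabla^F_{\nabla})$. Let $m_1=\dim\ker F_*$ and $m_2=\operatorname{rank}F$. Let $\mathcal H$ be the orthogonal projection of $TM_1$ onto $(\ker F_*)^\perp$, and let $$\mu=\frac1{m_1}\sum_{r=1}^{m_1}\mathcal H(\nabla_{u_r}u_r),\qquad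 H_2=\frac1{m_2}\sum_{i=1}^{m_2}\bigl(\nabla^F_{e_i}F_*e_i\bigr)^{\perp}$$ be the mean curvature vector fields of $\ker F_*$ and $\operatorname{range}F_*$, where $(u_r)$ and $(e_i)$ are local orthonormal frames of $\ker F_*$ and $(\ker F_*)^\perp$, and $\perp$ denotes the component in $(\operatorname{range}F_*)^\perp$ (we set $\mu=0$ if $m_1=0$, and $H_2=0$ if $m_2=0$). For a section $V$ of $(\operatorname{range}F_*)^\perp$ let $\nabla^{F\perp}_{F_*X}V=\nabla^{F\perp}_XV$ and $-A_VF_*X$ be the components of $\nabla^F_XV$ in $(\operatorname{range}F_*)^\perp$ and in $\operatorname{range}F_*$, and let ${}^*F_*$ be the adjoint of $F_*$. All traces are taken over $TM_1$ with respect to $g_1$, the covariant derivatives in them being those of the one-form $(\nabla F_*)(\cdot,\mu)$ and of the endomorphism field ${}^*F_*\circ A_{H_2}\circ F_*$. Suppose that the mean curvature vector fields of $\ker F_*$ and $\operatorname{range}F_*$ are parallel: $\nabla_X\mu=0$ and $\nabla^{F\perp}_XH_2=0$ for all $X\in TM_1$. Then $F$ is biharmonic if and only if $$m_1\operatorname{trace}A_{(\nabla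 F_*)(\cdot,\mu)}F_*(\cdot)-m_2\operatorname{trace}F_*\bigl(\nabla_{(\cdot)}{}^*F_*(A_{H_2}F_*(\cdot))\bigr)-m_1c(m_2-1)F_*(\mu)=0$$ and $$m_1\operatorname{trace}\nabla^{F\perp}_{F_*(\cdot)}(\nabla F_*)(\cdot,\mu)+m_2\operatorname{trace}(\nabla F_*)(\cdot,{}^*F_*(A_{H_2}F_*(\cdot)))-m_2^2cH_2=0.$$ -/

import Mathlib

open Bundle Manifold
open scoped ContDiff InnerProductSpace

noncomputable section

namespace RiemMap

/-- The trace `∑ i, b (e i) (e i)`, over an orthonormal basis, of a (bilinear) map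
`b : V × V → W`. -/
def trace {V W : Type*} [NormedAddCommGroup V] [InnerProductSpace ℝ V] [FiniteDimensional ℝ V]
    [AddCommGroup W] (b : V → V → W) : W :=
  ∑ i, b (stdOrthonormalBasis ℝ V i) (stdOrthonormalBasis ℝ V i)

/-- The trace over an orthonormal basis of the subspace `K`. -/
def traceOn {V W : Type*} [NormedAddCommGroup V] [InnerProductSpace ℝ V] [FiniteDimensional ℝ V]
    [AddCommGroup W] (K : Submodule ℝ V) (b : V → V → W) : W :=
  trace (V := K) fun u v ↦ b u v

section OneManifold

variable {E : Type*} [NormedAddCommGroup E] [NormedSpace ℝ E] [FiniteDimensional ℝ E]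
  {M : Type*} [TopologicalSpace M] [ChartedSpace E M] [IsManifold 𝓘(ℝ, E) ∞ M]
  [RiemannianBundle (fun p : M ↦ TangentSpace 𝓘(ℝ, E) p)]

instance finiteDimensionalTangentSpace (p : M) :
    FiniteDimensional ℝ (TangentSpace 𝓘(ℝ, E) p) :=
  inferInstanceAs (FiniteDimensional ℝ E)

/-- Extension of a tangent vector `v` at `p` to the vector field with constant components in the
preferred chart at `p`. -/
def ext {p : M} (v : TangentSpace 𝓘(ℝ, E) p) (q : M) : TangentSpace 𝓘(ℝ, E) q :=
  FiberBundle.extend E v q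

/-- The Christoffel symbol `Γ(u, v)` at `p` of the metric in the preferred chart at `p`. With
`U`, `V`, `W` the fields of constant components extending `u`, `v`, `w`, it is given by
`g(Γ(u, v), w) = (u g(V, W) + v g(U, W) - w g(U, V)) / 2`, the Koszul formula for commuting
fields. -/
def christoffel (p : M) (u v : TangentSpace 𝓘(ℝ, E) p) : TangentSpace 𝓘(ℝ, E) p :=
  ∑ k, ((1 / 2 : ℝ) *
    (mvfderiv 𝓘(ℝ, E)
        (fun q ↦ ⟪ext v q, ext (stdOrthonormalBasis ℝ (TangentSpace 𝓘(ℝ, E) p) k) q⟫_ℝ) p u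
      + mvfderiv 𝓘(ℝ, E)
        (fun q ↦ ⟪ext u q, ext (stdOrthonormalBasis ℝ (TangentSpace 𝓘(ℝ, E) p) k) q⟫_ℝ) p v
      - mvfderiv 𝓘(ℝ, E) (fun q ↦ ⟪ext u q, ext v q⟫_ℝ) p
          (stdOrthonormalBasis ℝ (TangentSpace 𝓘(ℝ, E) p) k)))
    • stdOrthonormalBasis ℝ (TangentSpace 𝓘(ℝ, E) p) k

end OneManifold

variable {E₁ : Type*} [NormedAddCommGroup E₁] [NormedSpace ℝ E₁] [FiniteDimensional ℝ E₁]
  {M₁ : Type*} [TopologicalSpace M₁] [ChartedSpace E₁ M₁] [IsManifold 𝓘(ℝ, E₁) ∞ M₁]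
  [RiemannianBundle (fun p : M₁ ↦ TangentSpace 𝓘(ℝ, E₁) p)]
  {E₂ : Type*} [NormedAddCommGroup E₂] [NormedSpace ℝ E₂] [FiniteDimensional ℝ E₂]
  {M₂ : Type*} [TopologicalSpace M₂] [ChartedSpace E₂ M₂] [IsManifold 𝓘(ℝ, E₂) ∞ M₂]
  [RiemannianBundle (fun p : M₂ ↦ TangentSpace 𝓘(ℝ, E₂) p)]

/-- The pullback `∇^F` of the Levi-Civita connection of `M₂` along `F`, acting on a section `s` of
`F⁻¹(TM₂)`: `∇^F_x s = x(sʲ) ∂ⱼ + Γ(F_* x, s)` in the preferred chart at `F p`. -/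
def covAlong (F : M₁ → M₂) (s : ∀ q, TangentSpace 𝓘(ℝ, E₂) (F q)) (p : M₁)
    (x : TangentSpace 𝓘(ℝ, E₁) p) : TangentSpace 𝓘(ℝ, E₂) (F p) :=
  (trivializationAt E₂ (TangentSpace 𝓘(ℝ, E₂)) (F p)).symm (F p)
      (mvfderiv 𝓘(ℝ, E₁)
        (fun q ↦ (trivializationAt E₂ (TangentSpace 𝓘(ℝ, E₂)) (F p) ⟨F q, s q⟩).2) p x)
    + christoffel (F p) (mfderiv 𝓘(ℝ, E₁) 𝓘(ℝ, E₂) F p x) (s p)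

/-- The Levi-Civita connection: `leviCivita Y p x` is `∇_x Y` at `p`. -/
def leviCivita (Y : ∀ q : M₁, TangentSpace 𝓘(ℝ, E₁) q) (p : M₁) (x : TangentSpace 𝓘(ℝ, E₁) p) :
    TangentSpace 𝓘(ℝ, E₁) p :=
  covAlong (fun q : M₁ ↦ q) Y p x

/-- The curvature operator `R(x, y)z = ∇_x ∇_Y Z - ∇_y ∇_X Z - ∇_[X, Y] Z`. -/
def curvature (p : M₁) (x y z : TangentSpace 𝓘(ℝ, E₁) p) : TangentSpace 𝓘(ℝ, E₁) p :=
  leviCivita (fun q ↦ leviCivita (ext z) q (ext y q)) p x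
    - leviCivita (fun q ↦ leviCivita (ext z) q (ext x q)) p y
    - leviCivita (ext z) p (VectorField.mlieBracket 𝓘(ℝ, E₁) (ext x) (ext y) p)

variable (E₁ M₁) in
/-- `R(X, Y)Z = c (g(Y, Z) X - g(X, Z) Y)`: constant sectional curvature `c`. -/
def IsSpaceForm (c : ℝ) : Prop :=
  ∀ (p : M₁) (x y z : TangentSpace 𝓘(ℝ, E₁) p),
    curvature p x y z = c • (⟪y, z⟫_ℝ • x - ⟪x, z⟫_ℝ • y)

/-- The differential `F_*` at `p`. -/
def d (F : C^∞⟮𝓘(ℝ, E₁), M₁; 𝓘(ℝ, E₂), M₂⟯) (p : M₁) :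
    TangentSpace 𝓘(ℝ, E₁) p →L[ℝ] TangentSpace 𝓘(ℝ, E₂) (F p) :=
  mfderiv 𝓘(ℝ, E₁) 𝓘(ℝ, E₂) F p

/-- The second fundamental form `(∇F_*)(x, y) = ∇^F_x F_*(Y) - F_*(∇_x Y)`. -/
def secondFF (F : C^∞⟮𝓘(ℝ, E₁), M₁; 𝓘(ℝ, E₂), M₂⟯) (p : M₁) (x y : TangentSpace 𝓘(ℝ, E₁) p) :
    TangentSpace 𝓘(ℝ, E₂) (F p) :=
  covAlong F (fun q ↦ d F q (ext y q)) p x - d F p (leviCivita (ext y) p x)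

/-- The tension field `τ(F) = trace ∇F_*`. -/
def tension (F : C^∞⟮𝓘(ℝ, E₁), M₁; 𝓘(ℝ, E₂), M₂⟯) (p : M₁) : TangentSpace 𝓘(ℝ, E₂) (F p) :=
  trace (secondFF F p)

/-- The Laplacian `-trace (∇^F ∇^F - ∇^F_∇)` on sections of `F⁻¹(TM₂)`. -/
def laplacian (F : C^∞⟮𝓘(ℝ, E₁), M₁; 𝓘(ℝ, E₂), M₂⟯) (s : ∀ q, TangentSpace 𝓘(ℝ, E₂) (F q)) (p : M₁) :
    TangentSpace 𝓘(ℝ, E₂) (F p) :=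
  -trace fun x y : TangentSpace 𝓘(ℝ, E₁) p ↦
    covAlong F (fun q ↦ covAlong F s q (ext y q)) p x - covAlong F s p (leviCivita (ext y) p x)

/-- The bitension field `-Δτ - trace R(F_*, τ)F_*`. -/
def bitension (F : C^∞⟮𝓘(ℝ, E₁), M₁; 𝓘(ℝ, E₂), M₂⟯) (p : M₁) : TangentSpace 𝓘(ℝ, E₂) (F p) :=
  -laplacian F (tension F) p
    - trace fun x y : TangentSpace 𝓘(ℝ, E₁) p ↦
        curvature (F p) (d F p x) (tension F p) (d F p y)

/-- Biharmonic maps: the Euler-Lagrange equation of the bienergy holds. -/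
def IsBiharmonic (F : C^∞⟮𝓘(ℝ, E₁), M₁; 𝓘(ℝ, E₂), M₂⟯) : Prop :=
  ∀ p, bitension F p = 0

/-- The kernel of `F_*` at `p`. -/
def ker (F : C^∞⟮𝓘(ℝ, E₁), M₁; 𝓘(ℝ, E₂), M₂⟯) (p : M₁) : Submodule ℝ (TangentSpace 𝓘(ℝ, E₁) p) :=
  LinearMap.ker (d F p).toLinearMap

/-- The range of `F_*` at `p`. -/
def range (F : C^∞⟮𝓘(ℝ, E₁), M₁; 𝓘(ℝ, E₂), M₂⟯) (p : M₁) : Submodule ℝ (TangentSpace 𝓘(ℝ, E₂) (F p)) :=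
  LinearMap.range (d F p).toLinearMap

/-- Riemannian maps: smooth maps whose differential is isometric on `(ker F_*)ᗮ`. -/
def IsRiemannianMap (F : C^∞⟮𝓘(ℝ, E₁), M₁; 𝓘(ℝ, E₂), M₂⟯) : Prop :=
  ∀ (p : M₁), ∀ x ∈ (ker F p)ᗮ, ∀ y ∈ (ker F p)ᗮ,
    ⟪d F p x, d F p y⟫_ℝ = ⟪x, y⟫_ℝ

/-- Orthogonal projection onto `ker F_*`. -/
def vert (F : C^∞⟮𝓘(ℝ, E₁), M₁; 𝓘(ℝ, E₂), M₂⟯) (p : M₁) (x : TangentSpace 𝓘(ℝ, E₁) p) : TangentSpace 𝓘(ℝ, E₁) p :=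
  (ker F p).starProjection x

/-- Orthogonal projection onto `(ker F_*)ᗮ`. -/
def hor (F : C^∞⟮𝓘(ℝ, E₁), M₁; 𝓘(ℝ, E₂), M₂⟯) (p : M₁) (x : TangentSpace 𝓘(ℝ, E₁) p) : TangentSpace 𝓘(ℝ, E₁) p :=
  (ker F p)ᗮ.starProjection x

/-- Orthogonal projection onto `range F_*`. -/
def tang (F : C^∞⟮𝓘(ℝ, E₁), M₁; 𝓘(ℝ, E₂), M₂⟯) (p : M₁) (w : TangentSpace 𝓘(ℝ, E₂) (F p)) :
    TangentSpace 𝓘(ℝ, E₂) (F p) :=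
  (range F p).starProjection w

/-- Orthogonal projection onto `(range F_*)ᗮ`. -/
def nor (F : C^∞⟮𝓘(ℝ, E₁), M₁; 𝓘(ℝ, E₂), M₂⟯) (p : M₁) (w : TangentSpace 𝓘(ℝ, E₂) (F p)) :
    TangentSpace 𝓘(ℝ, E₂) (F p) :=
  (range F p)ᗮ.starProjection w

/-- `m₁ = dim ker F_*`. -/
def dimKer (F : C^∞⟮𝓘(ℝ, E₁), M₁; 𝓘(ℝ, E₂), M₂⟯) (p : M₁) : ℕ := Module.finrank ℝ (ker F p)

/-- `m₂ = rank F`. -/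
def rank (F : C^∞⟮𝓘(ℝ, E₁), M₁; 𝓘(ℝ, E₂), M₂⟯) (p : M₁) : ℕ := Module.finrank ℝ (range F p)

/-- The adjoint `*F_*` of `F_*` at `p`. -/
def adj (F : C^∞⟮𝓘(ℝ, E₁), M₁; 𝓘(ℝ, E₂), M₂⟯) (p : M₁) :
    TangentSpace 𝓘(ℝ, E₂) (F p) →ₗ[ℝ] TangentSpace 𝓘(ℝ, E₁) p :=
  LinearMap.adjoint (d F p).toLinearMap

/-- The mean curvature vector field `μ` of the distribution `ker F_*`:
`(1/m₁) ∑ 𝓗(∇_{e_r} e_r)` over an orthonormal frame of `ker F_*`; the `r`-th term is the value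
on `(e_r, e_r)` of the tensor `(x, y) ↦ 𝓗(∇_x 𝓥Y)`. It is `0` where `ker F_* = 0`. -/
def kerMean (F : C^∞⟮𝓘(ℝ, E₁), M₁; 𝓘(ℝ, E₂), M₂⟯) (p : M₁) : TangentSpace 𝓘(ℝ, E₁) p :=
  (dimKer F p : ℝ)⁻¹ • traceOn (ker F p) fun x y ↦
    hor F p (leviCivita (fun q ↦ vert F q (ext y q)) p x)

/-- The mean curvature vector field `H₂` of `range F_*`, a section along `F`: `(1/m₂)` times the
sum of the normal components of `∇^F_{e_i} F_*(e_i)` over an orthonormal frame of `(ker F_*)ᗮ`.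
It is `0` where `range F_* = 0`. -/
def rangeMean (F : C^∞⟮𝓘(ℝ, E₁), M₁; 𝓘(ℝ, E₂), M₂⟯) (p : M₁) : TangentSpace 𝓘(ℝ, E₂) (F p) :=
  (rank F p : ℝ)⁻¹ • traceOn (ker F p)ᗮ fun x y ↦
    nor F p (covAlong F (fun q ↦ d F q (ext y q)) p x)

/-- The connection `∇^{F⊥}` on `(range F_*)ᗮ`: the normal component of `∇^F_x V`. -/
def normalCov (F : C^∞⟮𝓘(ℝ, E₁), M₁; 𝓘(ℝ, E₂), M₂⟯) (V : ∀ q, TangentSpace 𝓘(ℝ, E₂) (F q)) (p : M₁)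
    (x : TangentSpace 𝓘(ℝ, E₁) p) : TangentSpace 𝓘(ℝ, E₂) (F p) :=
  nor F p (covAlong F V p x)

/-- The shape operator, `A_v F_*(x) = -(∇^F_x V)^tangential`, for `v` normal to `range F_*` and
`V` a normal section along `F` that extends `v`. As `A_v` acts on vectors `w` of `range F_*`, the
vector `w` is lifted to `*F_*(w)`, the horizontal vector that `F_*` sends to `w`. -/
def shape (F : C^∞⟮𝓘(ℝ, E₁), M₁; 𝓘(ℝ, E₂), M₂⟯) (p : M₁) (v w : TangentSpace 𝓘(ℝ, E₂) (F p)) :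
    TangentSpace 𝓘(ℝ, E₂) (F p) :=
  -tang F p (covAlong F (fun q ↦ nor F q (ext v (F q))) p (adj F p w))

/-- The field of endomorphisms `*F_* ∘ A_{H₂} ∘ F_*` of `TM₁`. -/
def meanShape (F : C^∞⟮𝓘(ℝ, E₁), M₁; 𝓘(ℝ, E₂), M₂⟯) (p : M₁) (x : TangentSpace 𝓘(ℝ, E₁) p) :
    TangentSpace 𝓘(ℝ, E₁) p :=
  adj F p (shape F p (rangeMean F p) (d F p x))

/-- `∇μ = 0` for the mean curvature vector field `μ` of `ker F_*`. -/
def KerMeanParallel (F : C^∞⟮𝓘(ℝ, E₁), M₁; 𝓘(ℝ, E₂), M₂⟯) : Prop :=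
  ∀ (p : M₁) (x : TangentSpace 𝓘(ℝ, E₁) p), leviCivita (kerMean F) p x = 0

/-- `∇^{F⊥} H₂ = 0` for the mean curvature vector field `H₂` of `range F_*`. -/
def RangeMeanParallel (F : C^∞⟮𝓘(ℝ, E₁), M₁; 𝓘(ℝ, E₂), M₂⟯) : Prop :=
  ∀ (p : M₁) (x : TangentSpace 𝓘(ℝ, E₁) p), normalCov F (rangeMean F) p x = 0

/-- `trace A_{(∇F_*)(·, μ)} F_*(·)`. -/
def traceShape (F : C^∞⟮𝓘(ℝ, E₁), M₁; 𝓘(ℝ, E₂), M₂⟯) (p : M₁) : TangentSpace 𝓘(ℝ, E₂) (F p) :=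
  trace fun x y : TangentSpace 𝓘(ℝ, E₁) p ↦ shape F p (secondFF F p x (kerMean F p)) (d F p y)

/-- `trace F_*(∇_(·) *F_*(A_{H₂} F_*(·)))`, the trace of `(x, y) ↦ F_*((∇_x T) y)` where
`T = *F_* ∘ A_{H₂} ∘ F_*`. -/
def traceNablaMeanShape (F : C^∞⟮𝓘(ℝ, E₁), M₁; 𝓘(ℝ, E₂), M₂⟯) (p : M₁) : TangentSpace 𝓘(ℝ, E₂) (F p) :=
  trace fun x y : TangentSpace 𝓘(ℝ, E₁) p ↦
    d F p (leviCivita (fun q ↦ meanShape F q (ext y q)) p x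
      - meanShape F p (leviCivita (ext y) p x))

/-- `trace ∇^{F⊥}_{F_*(·)} (∇F_*)(·, μ)`, the trace of the normal covariant derivative
`(x, y) ↦ (∇^{F⊥}_x S)(y)` of the one-form `S = (∇F_*)(·, μ)`. -/
def traceNormalCovSecondFF (F : C^∞⟮𝓘(ℝ, E₁), M₁; 𝓘(ℝ, E₂), M₂⟯) (p : M₁) : TangentSpace 𝓘(ℝ, E₂) (F p) :=
  trace fun x y : TangentSpace 𝓘(ℝ, E₁) p ↦
    normalCov F (fun q ↦ secondFF F q (ext y q) (kerMean F q)) p x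
      - nor F p (secondFF F p (leviCivita (ext y) p x) (kerMean F p))

/-- `trace (∇F_*)(·, *F_*(A_{H₂} F_*(·)))`. -/
def traceSecondFFMeanShape (F : C^∞⟮𝓘(ℝ, E₁), M₁; 𝓘(ℝ, E₂), M₂⟯) (p : M₁) : TangentSpace 𝓘(ℝ, E₂) (F p) :=
  trace fun x y : TangentSpace 𝓘(ℝ, E₁) p ↦ secondFF F p x (meanShape F p y)

end RiemMap

end

/-!
The tension field of a Riemannian map splits as `τ = -m₁ F_* μ + m₂ H₂`, with `F_* μ` tangent and
`H₂` normal to the image (`tension_eq`). The two mean curvature fields being parallel, only first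
derivatives of a simple kind survive: `∇^F_x (F_* μ) = (∇F_*)(x, μ)`, because `∇μ = 0`, and
`∇^F_x H₂ = -F_*(T x)` with `T = *F_* ∘ A_{H₂} ∘ F_*`, because the normal part of `∇^F H₂`
vanishes (`d_meanShape`). Hence `∇^F τ = -m₁ S - m₂ F_* ∘ T` near every point, where
`S = (∇F_*)(·, μ)` (`covAlong_tension`). A second derivative and the trace give the Laplacian of
`τ` (`hessian_tension`), and the curvature of a space form gives the remaining term of the
bitension field (`trace_curvature_tension`). The result (`bitension_eq`) is the difference of the
left-hand sides of the two equations. The first is tangent to the image and the second is normal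
to it, so the bitension field vanishes if and only if both do.

Two facts about Riemannian maps decide what is tangent and what is normal. The form
`⟪(∇F_*)(x, y), F_* z⟫` is symmetric in `x, y`, and on horizontal vectors it is skew in `y, z`, as
follows from differentiating `⟪F_* Y, F_* Z⟫ = ⟪𝓗 Y, Z⟫` (`inner_secondFF_add`); so `∇F_*` is
normal on horizontal vectors (`secondFF_mem_orthogonal`). When `∇μ = 0` the same identity with
`Y = μ` makes `S` normal on all vectors (`secondFF_kerMean_mem`), and the Weingarten formula turns
the tangential part of `∇S` into the shape operator (`nabla_secondFF_kerMean`).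

The connections are given by Christoffel symbols in preferred charts, which change with the point.
The properties used of them are that they are metric (`mvfderiv_inner`), torsion-free
(`covAlong_mfderiv_comm`), subject to the chain rule (`covAlong_comp`), and that `∇^F_X s` is
smooth for smooth `X` and `s` (`smoothAt_covAlong`); tensoriality of `∇F_*` is `secondFF_eq`. The
fields `μ` and `H₂` are smooth because the rank of a Riemannian map is locally constant
(`eventually_rank_eq`) and the orthogonal projections are smooth, being expressed through `F_*`
and its adjoint.
-/

open scoped Topology

set_option linter.unusedSectionVars false

noncomputable section

namespace RiemMap

/-! ### Smooth sections along a map -/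

section SmoothSections

variable {E₁ : Type*} [NormedAddCommGroup E₁] [NormedSpace ℝ E₁]
  {M₁ : Type*} [TopologicalSpace M₁] [ChartedSpace E₁ M₁]
  {E₂ : Type*} [NormedAddCommGroup E₂] [NormedSpace ℝ E₂]
  {M₂ : Type*} [TopologicalSpace M₂] [ChartedSpace E₂ M₂] [IsManifold 𝓘(ℝ, E₂) ∞ M₂]

variable (E₁) in
/-- Smoothness at `p` of a section `s` of the pullback `F⁻¹(TM₂)`, as a map into the tangent
bundle of `M₂`; in particular `F` itself is smooth at `p`. Vector fields are the case `F = id`. -/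
def SmoothAt (F : M₁ → M₂) (s : ∀ q, TangentSpace 𝓘(ℝ, E₂) (F q)) (p : M₁) : Prop :=
  ContMDiffAt 𝓘(ℝ, E₁) (𝓘(ℝ, E₂).prod 𝓘(ℝ, E₂)) ∞
    (fun q ↦ (⟨F q, s q⟩ : TangentBundle 𝓘(ℝ, E₂) M₂)) p

/-- The components of a tangent vector `w` at `y` in the preferred chart at `x`. -/
def coord (x : M₂) {y : M₂} (w : TangentSpace 𝓘(ℝ, E₂) y) : E₂ :=
  (trivializationAt E₂ (TangentSpace 𝓘(ℝ, E₂)) x ⟨y, w⟩).2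

/-- The tangent vector at `y` with given components in the preferred chart at `x`. -/
def ofCoord (x y : M₂) (a : E₂) : TangentSpace 𝓘(ℝ, E₂) y :=
  (trivializationAt E₂ (TangentSpace 𝓘(ℝ, E₂)) x).symm y a

lemma coord_linear {x y : M₂} (hy : y ∈ (chartAt E₂ x).source) :
    ∃ L : TangentSpace 𝓘(ℝ, E₂) y →ₗ[ℝ] E₂, ∀ w, coord x w = L w :=
  ⟨(trivializationAt E₂ (TangentSpace 𝓘(ℝ, E₂)) x).linearMapAt ℝ y, fun w ↦ by
    rw [Trivialization.coe_linearMapAt_of_mem _ hy]; rfl⟩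

lemma coord_add {x y : M₂} (hy : y ∈ (chartAt E₂ x).source) (v w : TangentSpace 𝓘(ℝ, E₂) y) :
    coord x (v + w) = coord x v + coord x w := by
  obtain ⟨L, hL⟩ := coord_linear hy
  rw [hL, hL, hL, map_add]

lemma coord_smul {x y : M₂} (hy : y ∈ (chartAt E₂ x).source) (c : ℝ)
    (w : TangentSpace 𝓘(ℝ, E₂) y) : coord x (c • w) = c • coord x w := by
  obtain ⟨L, hL⟩ := coord_linear hy
  rw [hL, hL, map_smul]

lemma ofCoord_coord {x y : M₂} (hy : y ∈ (chartAt E₂ x).source) (w : TangentSpace 𝓘(ℝ, E₂) y) :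
    ofCoord x y (coord x w) = w :=
  (trivializationAt E₂ (TangentSpace 𝓘(ℝ, E₂)) x).symm_apply_apply_mk hy w

lemma coord_ofCoord {x y : M₂} (hy : y ∈ (chartAt E₂ x).source) (a : E₂) :
    coord x (ofCoord x y a) = a := by
  unfold coord ofCoord
  rw [Trivialization.apply_mk_symm _ hy]

lemma ofCoord_add {x y : M₂} (hy : y ∈ (chartAt E₂ x).source) (a b : E₂) :
    ofCoord x y (a + b) = ofCoord x y a + ofCoord x y b := by
  have h := ((trivializationAt E₂ (TangentSpace 𝓘(ℝ, E₂)) x).symmₗ ℝ y).map_add a b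
  rwa [Trivialization.coe_symmₗ _ hy] at h

lemma ofCoord_smul {x y : M₂} (hy : y ∈ (chartAt E₂ x).source) (c : ℝ) (a : E₂) :
    ofCoord x y (c • a) = c • ofCoord x y a := by
  have h := ((trivializationAt E₂ (TangentSpace 𝓘(ℝ, E₂)) x).symmₗ ℝ y).map_smul c a
  rwa [Trivialization.coe_symmₗ _ hy] at h

lemma coord_eq_mfderiv {x y : M₂} (hy : y ∈ (chartAt E₂ x).source) (w : TangentSpace 𝓘(ℝ, E₂) y) :
    coord x w = mfderiv 𝓘(ℝ, E₂) 𝓘(ℝ, E₂) (extChartAt 𝓘(ℝ, E₂) x) y w := by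
  refine Eq.trans ?_ (DFunLike.congr_fun
    (TangentBundle.continuousLinearMapAt_trivializationAt (I := 𝓘(ℝ, E₂)) hy) w)
  exact (congr_fun (Trivialization.coe_linearMapAt_of_mem (R := ℝ) _ hy) w).symm

lemma ext_eq_ofCoord {x : M₂} (v : TangentSpace 𝓘(ℝ, E₂) x) (y : M₂) :
    ext v y = ofCoord x y (coord x v) := rfl

@[simp] lemma ext_self {x : M₂} (v : TangentSpace 𝓘(ℝ, E₂) x) : ext v x = v :=
  FiberBundle.extend_apply_self E₂ v

lemma ext_add {x y : M₂} (hy : y ∈ (chartAt E₂ x).source) (v w : TangentSpace 𝓘(ℝ, E₂) x) :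
    ext (v + w) y = ext v y + ext w y := by
  rw [ext_eq_ofCoord, coord_add (mem_chart_source E₂ x), ofCoord_add hy]; rfl

lemma ext_smul {x y : M₂} (hy : y ∈ (chartAt E₂ x).source) (c : ℝ)
    (v : TangentSpace 𝓘(ℝ, E₂) x) :
    ext (c • v) y = c • ext v y := by
  rw [ext_eq_ofCoord, coord_smul (mem_chart_source E₂ x), ofCoord_smul hy]; rfl

/-- Smoothness may be tested in any preferred chart around `F p`, not only in the one at `F p`. -/
lemma smoothAt_iff_coord {F : M₁ → M₂} {s : ∀ q, TangentSpace 𝓘(ℝ, E₂) (F q)} {p : M₁} {x : M₂}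
    (hx : F p ∈ (chartAt E₂ x).source) :
    SmoothAt E₁ F s p ↔ ContMDiffAt 𝓘(ℝ, E₁) 𝓘(ℝ, E₂) ∞ F p ∧
      ContMDiffAt 𝓘(ℝ, E₁) 𝓘(ℝ, E₂) ∞ (fun q ↦ coord x (s q)) p :=
  Trivialization.contMDiffAt_iff (e := trivializationAt E₂ (TangentSpace 𝓘(ℝ, E₂)) x)
    (f := fun q ↦ (⟨F q, s q⟩ : TangentBundle 𝓘(ℝ, E₂) M₂))
    ((Trivialization.mem_source _).2 hx)

variable {F : M₁ → M₂} {s t : ∀ q, TangentSpace 𝓘(ℝ, E₂) (F q)} {p : M₁}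

lemma SmoothAt.base (hs : SmoothAt E₁ F s p) : ContMDiffAt 𝓘(ℝ, E₁) 𝓘(ℝ, E₂) ∞ F p :=
  ((smoothAt_iff_coord (mem_chart_source E₂ (F p))).1 hs).1

lemma SmoothAt.coord (hs : SmoothAt E₁ F s p) {x : M₂} (hx : F p ∈ (chartAt E₂ x).source) :
    ContMDiffAt 𝓘(ℝ, E₁) 𝓘(ℝ, E₂) ∞ (fun q ↦ coord x (s q)) p :=
  ((smoothAt_iff_coord hx).1 hs).2

omit [IsManifold 𝓘(ℝ, E₂) ∞ M₂] in
lemma eventually_mem_chart (hF : ContMDiffAt 𝓘(ℝ, E₁) 𝓘(ℝ, E₂) ∞ F p) {x : M₂}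
    (hx : F p ∈ (chartAt E₂ x).source) : ∀ᶠ q in 𝓝 p, F q ∈ (chartAt E₂ x).source :=
  hF.continuousAt.eventually ((chartAt E₂ x).open_source.mem_nhds hx)

lemma SmoothAt.congr (hs : SmoothAt E₁ F s p) (h : ∀ᶠ q in 𝓝 p, t q = s q) : SmoothAt E₁ F t p :=
  ContMDiffAt.congr_of_eventuallyEq hs (h.mono fun q hq ↦ by simp only [hq])

lemma SmoothAt.add (hs : SmoothAt E₁ F s p) (ht : SmoothAt E₁ F t p) :
    SmoothAt E₁ F (fun q ↦ s q + t q) p := by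
  have hx := mem_chart_source E₂ (F p)
  refine (smoothAt_iff_coord hx).2
    ⟨hs.base, ((hs.coord hx).add (ht.coord hx)).congr_of_eventuallyEq ?_⟩
  filter_upwards [eventually_mem_chart hs.base hx] with q hq
  simp [coord_add hq]

lemma SmoothAt.smul {f : M₁ → ℝ} (hf : ContMDiffAt 𝓘(ℝ, E₁) 𝓘(ℝ, ℝ) ∞ f p)
    (hs : SmoothAt E₁ F s p) : SmoothAt E₁ F (fun q ↦ f q • s q) p := by
  have hx := mem_chart_source E₂ (F p)
  refine (smoothAt_iff_coord hx).2 ⟨hs.base, (hf.smul (hs.coord hx)).congr_of_eventuallyEq ?_⟩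
  filter_upwards [eventually_mem_chart hs.base hx] with q hq
  simp [coord_smul hq]

lemma SmoothAt.const_smul (c : ℝ) (hs : SmoothAt E₁ F s p) : SmoothAt E₁ F (fun q ↦ c • s q) p :=
  hs.smul (f := fun _ ↦ c) contMDiffAt_const

lemma SmoothAt.neg (hs : SmoothAt E₁ F s p) : SmoothAt E₁ F (fun q ↦ -s q) p :=
  (hs.const_smul (-1)).congr (.of_forall fun q ↦ by simp)

lemma SmoothAt.sub (hs : SmoothAt E₁ F s p) (ht : SmoothAt E₁ F t p) :
    SmoothAt E₁ F (fun q ↦ s q - t q) p :=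
  (hs.add ht.neg).congr (.of_forall fun q ↦ by simp [sub_eq_add_neg])

lemma smoothAt_zero (hF : ContMDiffAt 𝓘(ℝ, E₁) 𝓘(ℝ, E₂) ∞ F p) :
    SmoothAt E₁ F (fun q ↦ (0 : TangentSpace 𝓘(ℝ, E₂) (F q))) p := by
  have hx := mem_chart_source E₂ (F p)
  refine (smoothAt_iff_coord hx).2
    ⟨hF, (contMDiffAt_const (c := (0 : E₂))).congr_of_eventuallyEq ?_⟩
  filter_upwards [eventually_mem_chart hF hx] with q hq
  obtain ⟨L, hL⟩ := coord_linear (E₂ := E₂) hq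
  rw [hL, map_zero]

lemma SmoothAt.sum {ι : Type*} (J : Finset ι) {s : ι → ∀ q, TangentSpace 𝓘(ℝ, E₂) (F q)}
    (hF : ContMDiffAt 𝓘(ℝ, E₁) 𝓘(ℝ, E₂) ∞ F p) (hs : ∀ i ∈ J, SmoothAt E₁ F (s i) p) :
    SmoothAt E₁ F (fun q ↦ ∑ i ∈ J, s i q) p := by
  classical
  induction J using Finset.induction_on with
  | empty => simpa using smoothAt_zero hF
  | insert i J hi ih =>
    simp only [Finset.sum_insert hi]
    exact (hs i (by simp)).add (ih fun j hj ↦ hs j (by simp [hj]))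

lemma SmoothAt.comp {Y : ∀ y : M₂, TangentSpace 𝓘(ℝ, E₂) y}
    (hY : SmoothAt E₂ (fun y ↦ y) Y (F p)) (hF : ContMDiffAt 𝓘(ℝ, E₁) 𝓘(ℝ, E₂) ∞ F p) :
    SmoothAt E₁ F (fun q ↦ Y (F q)) p :=
  ContMDiffAt.comp (g := fun y ↦ (⟨y, Y y⟩ : TangentBundle 𝓘(ℝ, E₂) M₂)) p hY hF

lemma smoothAt_ofCoord {x y : M₂} (hy : y ∈ (chartAt E₂ x).source) (a : E₂) :
    SmoothAt E₂ (fun y ↦ y) (fun y ↦ ofCoord x y a) y := by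
  refine (smoothAt_iff_coord hy).2
    ⟨contMDiffAt_id, (contMDiffAt_const (c := a)).congr_of_eventuallyEq ?_⟩
  filter_upwards [(chartAt E₂ x).open_source.mem_nhds hy] with q hq
  exact coord_ofCoord hq a

lemma smoothAt_ext {x y : M₂} (hy : y ∈ (chartAt E₂ x).source) (v : TangentSpace 𝓘(ℝ, E₂) x) :
    SmoothAt E₂ (fun y ↦ y) (ext v) y := smoothAt_ofCoord hy _

lemma smoothNear_ext {x : M₂} (v : TangentSpace 𝓘(ℝ, E₂) x) :
    ∀ᶠ y in 𝓝 x, SmoothAt E₂ (fun y ↦ y) (ext v) y :=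
  Filter.mem_of_superset ((chartAt E₂ x).open_source.mem_nhds (mem_chart_source E₂ x))
    fun _ hy ↦ smoothAt_ext hy v

variable [IsManifold 𝓘(ℝ, E₁) ∞ M₁]

/-- The differential of a smooth map sends smooth vector fields to smooth sections along the map. -/
lemma smoothAt_mfderiv {Y : ∀ q : M₁, TangentSpace 𝓘(ℝ, E₁) q}
    (hF : ContMDiffAt 𝓘(ℝ, E₁) 𝓘(ℝ, E₂) ∞ F p) (hY : SmoothAt E₁ (fun q ↦ q) Y p) :
    SmoothAt E₁ F (fun q ↦ mfderiv 𝓘(ℝ, E₁) 𝓘(ℝ, E₂) F q (Y q)) p := by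
  have hx := mem_chart_source E₂ (F p)
  have hp := mem_chart_source E₁ p
  refine (smoothAt_iff_coord hx).2 ⟨hF, ?_⟩
  refine ((hF.mfderiv_const (m := ∞) le_rfl).clm_apply
    (hY.coord (x := p) hp)).congr_of_eventuallyEq ?_
  filter_upwards [eventually_mem_chart hF hx, (chartAt E₁ p).open_source.mem_nhds hp] with q hq hq'
  rw [inTangentCoordinates_eq_mfderiv_comp (f := id) hq' hq]
  rw [coord_eq_mfderiv hq]
  refine congrArg (fun w : TangentSpace 𝓘(ℝ, E₁) q ↦
    mfderiv 𝓘(ℝ, E₂) 𝓘(ℝ, E₂) (extChartAt 𝓘(ℝ, E₂) (F p)) (F q)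
      (mfderiv 𝓘(ℝ, E₁) 𝓘(ℝ, E₂) F q w)) ?_
  refine (ofCoord_coord (E₂ := E₁) hq' (Y q)).symm.trans ?_
  exact ((trivializationAt E₁ (TangentSpace 𝓘(ℝ, E₁)) p).symmL_apply (R := ℝ) hq' _).symm.trans
    (DFunLike.congr_fun (TangentBundle.symmL_trivializationAt (I := 𝓘(ℝ, E₁)) hq') _)

omit [IsManifold 𝓘(ℝ, E₁) ∞ M₁] in
lemma mvfderiv_congr {E' : Type*} [NormedAddCommGroup E'] [NormedSpace ℝ E'] {f g : M₁ → E'}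
    (h : ∀ᶠ q in 𝓝 p, f q = g q) (v : TangentSpace 𝓘(ℝ, E₁) p) :
    mvfderiv 𝓘(ℝ, E₁) f p v = mvfderiv 𝓘(ℝ, E₁) g p v := by
  have e : (mfderiv 𝓘(ℝ, E₁) 𝓘(ℝ, E') f p : E₁ →L[ℝ] E') = mfderiv 𝓘(ℝ, E₁) 𝓘(ℝ, E') g p :=
    Filter.EventuallyEq.mfderiv_eq h
  exact DFunLike.congr_fun e v

lemma contMDiffAt_mvfderiv {E' : Type*} [NormedAddCommGroup E'] [NormedSpace ℝ E'] {f : M₁ → E'}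
    {Y : ∀ q : M₁, TangentSpace 𝓘(ℝ, E₁) q}
    (hf : ContMDiffAt 𝓘(ℝ, E₁) 𝓘(ℝ, E') ∞ f p) (hY : SmoothAt E₁ (fun q ↦ q) Y p) :
    ContMDiffAt 𝓘(ℝ, E₁) 𝓘(ℝ, E') ∞ (fun q ↦ mvfderiv 𝓘(ℝ, E₁) f q (Y q)) p := by
  have h := (smoothAt_mfderiv hf hY).coord (x := f p) (mem_chart_source E' (f p))
  refine h.congr_of_eventuallyEq (.of_forall fun q ↦ ?_)
  simp only [RiemMap.coord, trivializationAt_model_space_apply]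
  rfl

lemma mvfderiv_comp_chart {E' : Type*} [NormedAddCommGroup E'] [NormedSpace ℝ E'] {k : E₁ → E'}
    {x : M₁} (hp : p ∈ (chartAt E₁ x).source)
    (hk : DifferentiableAt ℝ k (extChartAt 𝓘(ℝ, E₁) x p)) (b : E₁) :
    mvfderiv 𝓘(ℝ, E₁) (fun q ↦ k (extChartAt 𝓘(ℝ, E₁) x q)) p (ofCoord x p b) =
      fderiv ℝ k (extChartAt 𝓘(ℝ, E₁) x p) b := by
  have hφ : MDifferentiableAt 𝓘(ℝ, E₁) 𝓘(ℝ, E₁) (extChartAt 𝓘(ℝ, E₁) x) p :=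
    mdifferentiableAt_extChartAt hp
  have h := mfderiv_comp_apply p (g := k) (f := extChartAt 𝓘(ℝ, E₁) x)
    hk.mdifferentiableAt hφ (ofCoord x p b)
  have h2 : mfderiv 𝓘(ℝ, E₁) 𝓘(ℝ, E₁) (extChartAt 𝓘(ℝ, E₁) x) p (ofCoord x p b) = b := by
    rw [← coord_eq_mfderiv hp]; exact coord_ofCoord hp b
  rw [h2, mfderiv_eq_fderiv] at h
  exact h

/-- Fields with constant components in one chart commute: `b (a h) = a (b h)`. -/
lemma mvfderiv_ofCoord_comm {E' : Type*} [NormedAddCommGroup E'] [NormedSpace ℝ E'] {h : M₁ → E'}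
    {x : M₁} (hp : p ∈ (chartAt E₁ x).source) (hh : ContMDiffAt 𝓘(ℝ, E₁) 𝓘(ℝ, E') ∞ h p)
    (a b : E₁) :
    mvfderiv 𝓘(ℝ, E₁) (fun q ↦ mvfderiv 𝓘(ℝ, E₁) h q (ofCoord x q a)) p (ofCoord x p b) =
      mvfderiv 𝓘(ℝ, E₁) (fun q ↦ mvfderiv 𝓘(ℝ, E₁) h q (ofCoord x q b)) p (ofCoord x p a) := by
  set φ := extChartAt 𝓘(ℝ, E₁) x with hφ
  set k : E₁ → E' := fun y ↦ h (φ.symm y) with hk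
  have hps : p ∈ φ.source := by rwa [hφ, extChartAt_source]
  have hkp : ContDiffAt ℝ ∞ k (φ p) := by
    rw [← contMDiffAt_iff_contDiffAt]
    have h1 : ContMDiffAt 𝓘(ℝ, E₁) 𝓘(ℝ, E₁) ∞ φ.symm (φ p) :=
      (contMDiffOn_extChartAt_symm x).contMDiffAt
        ((isOpen_extChartAt_target x).mem_nhds (φ.map_source hps))
    have h2 : ContMDiffAt 𝓘(ℝ, E₁) 𝓘(ℝ, E') ∞ h (φ.symm (φ p)) := by rwa [φ.left_inv hps]
    exact h2.comp (φ p) h1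
  have hkd : ∀ᶠ y in 𝓝 (φ p), DifferentiableAt ℝ k y :=
    ((hkp.of_le (m := 1) (by norm_cast)).eventually (by simp)).mono
      fun y hy ↦ hy.differentiableAt (by simp)
  have hφc : ContinuousAt φ p := (continuousOn_extChartAt x).continuousAt
    ((isOpen_extChartAt_source x).mem_nhds hps)
  have hsrc : ∀ᶠ q in 𝓝 p, q ∈ φ.source := (isOpen_extChartAt_source x).mem_nhds hps
  -- in the chart, the derivative along a constant field is a directional derivative
  have hD : ∀ c : E₁, ∀ᶠ q in 𝓝 p,
      mvfderiv 𝓘(ℝ, E₁) h q (ofCoord x q c) = fderiv ℝ k (φ q) c := by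
    intro c
    filter_upwards [hφc.eventually hkd, hsrc.eventually_nhds] with q hq hq'
    have hqs : q ∈ (chartAt E₁ x).source := by
      have := hq'.self_of_nhds; rwa [hφ, extChartAt_source] at this
    rw [← mvfderiv_comp_chart hqs hq c]
    exact mvfderiv_congr (hq'.mono fun q' h' ↦ by simp only [hk, ← hφ, φ.left_inv h']) _
  have hD2 : ∀ c d : E₁,
      mvfderiv 𝓘(ℝ, E₁) (fun q ↦ mvfderiv 𝓘(ℝ, E₁) h q (ofCoord x q c)) p (ofCoord x p d) =
        fderiv ℝ (fderiv ℝ k) (φ p) d c := by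
    intro c d
    have hd : DifferentiableAt ℝ (fderiv ℝ k) (φ p) :=
      (hkp.fderiv_right (m := 1) (by norm_cast)).differentiableAt (by simp)
    have e1 := mvfderiv_comp_chart (k := fun y ↦ fderiv ℝ k y c) hp
      (hd.clm_apply (differentiableAt_const c)) d
    rw [fderiv_clm_apply hd (differentiableAt_const c)] at e1
    simp only [fderiv_fun_const, Pi.zero_apply, ContinuousLinearMap.comp_zero, zero_add,
      ContinuousLinearMap.flip_apply] at e1
    rw [← e1]
    exact mvfderiv_congr (hD c) _
  rw [hD2, hD2]
  exact (hkp.isSymmSndFDerivAt (by simp; norm_cast)).eq b a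

end SmoothSections

/-! ### Coordinate fields and orthonormal frames -/

section Frames

variable {E₁ : Type*} [NormedAddCommGroup E₁] [NormedSpace ℝ E₁]
  {M₁ : Type*} [TopologicalSpace M₁] [ChartedSpace E₁ M₁]
  {E₂ : Type*} [NormedAddCommGroup E₂] [NormedSpace ℝ E₂] [FiniteDimensional ℝ E₂]
  {M₂ : Type*} [TopologicalSpace M₂] [ChartedSpace E₂ M₂] [IsManifold 𝓘(ℝ, E₂) ∞ M₂]
  {F : M₁ → M₂} {s t : ∀ q, TangentSpace 𝓘(ℝ, E₂) (F q)} {p : M₁}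

/-- The components of a tangent vector `w` with respect to the coordinate fields of the preferred
chart at `x`. -/
def chartComp (x : M₂) {y : M₂} (w : TangentSpace 𝓘(ℝ, E₂) y) (i : Fin (Module.finrank ℝ E₂)) : ℝ :=
  (Module.finBasis ℝ E₂).repr (coord x w) i

/-- The coordinate fields of the preferred chart at `x`. -/
def coordField (x : M₂) (i : Fin (Module.finrank ℝ E₂)) (y : M₂) : TangentSpace 𝓘(ℝ, E₂) y :=
  ofCoord x y (Module.finBasis ℝ E₂ i)

lemma chartComp_add {x y : M₂} (hy : y ∈ (chartAt E₂ x).source) (v w : TangentSpace 𝓘(ℝ, E₂) y)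
    (i : Fin (Module.finrank ℝ E₂)) :
    chartComp x (v + w) i = chartComp x v i + chartComp x w i := by
  simp [chartComp, coord_add hy]

lemma chartComp_smul {x y : M₂} (hy : y ∈ (chartAt E₂ x).source) (c : ℝ)
    (w : TangentSpace 𝓘(ℝ, E₂) y) (i : Fin (Module.finrank ℝ E₂)) :
    chartComp x (c • w) i = c * chartComp x w i := by
  simp [chartComp, coord_smul hy]

lemma sum_chartComp_smul_coordField {x y : M₂} (hy : y ∈ (chartAt E₂ x).source)
    (w : TangentSpace 𝓘(ℝ, E₂) y) : ∑ i, chartComp x w i • coordField x i y = w := by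
  obtain ⟨L, hL⟩ := coord_linear (E₂ := E₂) hy
  have hinj : Function.Injective L := fun u v h ↦ by
    rw [← hL, ← hL] at h
    rw [← ofCoord_coord hy u, h, ofCoord_coord hy]
  apply hinj
  simp_rw [map_sum, map_smul, ← hL, coordField, coord_ofCoord hy]
  exact (Module.finBasis ℝ E₂).sum_repr (coord x w)

lemma linearIndependent_coordField {x y : M₂} (hy : y ∈ (chartAt E₂ x).source) :
    LinearIndependent ℝ (fun i ↦ coordField (E₂ := E₂) x i y) := by
  obtain ⟨L, hL⟩ := coord_linear (E₂ := E₂) hy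
  refine LinearIndependent.of_comp L ?_
  convert (Module.finBasis ℝ E₂).linearIndependent using 1
  funext i
  exact (hL _).symm.trans (coord_ofCoord hy _)

lemma smoothAt_coordField {x y : M₂} (hy : y ∈ (chartAt E₂ x).source)
    (i : Fin (Module.finrank ℝ E₂)) : SmoothAt E₂ (fun y ↦ y) (coordField x i) y :=
  smoothAt_ofCoord hy _

lemma SmoothAt.contMDiffAt_chartComp (hs : SmoothAt E₁ F s p) {x : M₂}
    (hx : F p ∈ (chartAt E₂ x).source) (i : Fin (Module.finrank ℝ E₂)) :
    ContMDiffAt 𝓘(ℝ, E₁) 𝓘(ℝ, ℝ) ∞ (fun q ↦ chartComp x (s q) i) p := by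
  have h : ContDiff ℝ ∞ ((Module.finBasis ℝ E₂).coord i : E₂ → ℝ) :=
    (LinearMap.toContinuousLinearMap ((Module.finBasis ℝ E₂).coord i)).contDiff
  exact h.contMDiff.contMDiffAt.comp p (hs.coord hx)

/-- Induction on smooth sections along `F`: a property that is local and stable under sums and under
products with functions holds once it holds for the coordinate fields. -/
lemma SmoothAt.induction {P : (∀ q, TangentSpace 𝓘(ℝ, E₂) (F q)) → Prop}
    (hF : ContMDiffAt 𝓘(ℝ, E₁) 𝓘(ℝ, E₂) ∞ F p)
    (congr : ∀ s t, SmoothAt E₁ F s p → (∀ᶠ q in 𝓝 p, t q = s q) → P s → P t)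
    (zero : P fun _ ↦ 0)
    (add : ∀ s t, SmoothAt E₁ F s p → SmoothAt E₁ F t p → P s → P t → P fun q ↦ s q + t q)
    (smul : ∀ (f : M₁ → ℝ) s, ContMDiffAt 𝓘(ℝ, E₁) 𝓘(ℝ, ℝ) ∞ f p → SmoothAt E₁ F s p → P s →
      P fun q ↦ f q • s q)
    (frame : ∀ i, P fun q ↦ coordField (F p) i (F q))
    (s : ∀ q, TangentSpace 𝓘(ℝ, E₂) (F q)) (hs : SmoothAt E₁ F s p) : P s := by
  classical
  have hx := mem_chart_source E₂ (F p)
  have hsm : ∀ i, SmoothAt E₁ F (fun q ↦ chartComp (F p) (s q) i • coordField (F p) i (F q)) p :=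
    fun i ↦ SmoothAt.smul (hs.contMDiffAt_chartComp hx i) ((smoothAt_coordField hx i).comp hF)
  have key : ∀ J : Finset (Fin (Module.finrank ℝ E₂)),
      P fun q ↦ ∑ i ∈ J, chartComp (F p) (s q) i • coordField (F p) i (F q) := by
    intro J
    induction J using Finset.induction_on with
    | empty => simpa using zero
    | insert i J hi ih =>
      simp only [Finset.sum_insert hi]
      exact add _ _ (hsm i) (SmoothAt.sum J hF fun j _ ↦ hsm j)
        (smul _ _ (hs.contMDiffAt_chartComp hx i) ((smoothAt_coordField hx i).comp hF) (frame i)) ih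
  refine congr _ s (SmoothAt.sum Finset.univ hF fun j _ ↦ hsm j) ?_ (key Finset.univ)
  filter_upwards [eventually_mem_chart hF hx] with q hq
  exact (sum_chartComp_smul_coordField hq (s q)).symm

variable [RiemannianBundle (fun p : M₂ ↦ TangentSpace 𝓘(ℝ, E₂) p)]
  [IsContMDiffRiemannianBundle 𝓘(ℝ, E₂) ∞ E₂ (fun p : M₂ ↦ TangentSpace 𝓘(ℝ, E₂) p)]

omit [FiniteDimensional ℝ E₂] in
lemma SmoothAt.inner (hs : SmoothAt E₁ F s p) (ht : SmoothAt E₁ F t p) :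
    ContMDiffAt 𝓘(ℝ, E₁) 𝓘(ℝ, ℝ) ∞ (fun q ↦ ⟪s q, t q⟫_ℝ) p :=
  ContMDiffAt.inner_bundle hs ht

/-- The orthonormal frame obtained from the coordinate fields of the preferred chart at `x` by the
Gram–Schmidt process. -/
def orthoFrame (x : M₂) (i : Fin (Module.finrank ℝ E₂)) (y : M₂) : TangentSpace 𝓘(ℝ, E₂) y :=
  InnerProductSpace.gramSchmidtNormed ℝ (fun j ↦ coordField x j y) i

lemma smoothAt_orthoFrame {x y : M₂} (hy : y ∈ (chartAt E₂ x).source)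
    (i : Fin (Module.finrank ℝ E₂)) : SmoothAt E₂ (fun y ↦ y) (orthoFrame x i) y := by
  have hne : ∀ j, InnerProductSpace.gramSchmidt ℝ (fun j ↦ coordField (E₂ := E₂) x j y) j ≠ 0 :=
    fun j ↦ InnerProductSpace.gramSchmidt_ne_zero j (linearIndependent_coordField hy)
  have key : ∀ j, SmoothAt E₂ (fun y ↦ y)
      (fun y ↦ InnerProductSpace.gramSchmidt ℝ (fun j ↦ coordField (E₂ := E₂) x j y) j) y := by
    intro j
    induction j using WellFoundedLT.induction with
    | ind j ih =>
      simp_rw [InnerProductSpace.gramSchmidt_def ℝ _ j, Submodule.starProjection_singleton]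
      refine (smoothAt_coordField hy j).sub (SmoothAt.sum _ contMDiffAt_id fun k hk ↦ ?_)
      have hk' := ih k (Finset.mem_Iio.1 hk)
      refine SmoothAt.smul ?_ hk'
      simp_rw [RCLike.ofReal_real_eq_id, id, ← real_inner_self_eq_norm_sq]
      exact (hk'.inner (smoothAt_coordField hy j)).div₀ (hk'.inner hk')
        (inner_self_ne_zero.2 (hne k))
  refine SmoothAt.smul (f := fun y ↦
    ‖InnerProductSpace.gramSchmidt ℝ (fun j ↦ coordField (E₂ := E₂) x j y) i‖⁻¹) ?_ (key i)
  simp_rw [norm_eq_sqrt_real_inner]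
  have h0 : ⟪InnerProductSpace.gramSchmidt ℝ (fun j ↦ coordField (E₂ := E₂) x j y) i,
    InnerProductSpace.gramSchmidt ℝ (fun j ↦ coordField (E₂ := E₂) x j y) i⟫_ℝ ≠ 0 :=
    inner_self_ne_zero.2 (hne i)
  exact ((Real.contDiffAt_sqrt h0).contMDiffAt.comp y ((key i).inner (key i))).inv₀
    (Real.sqrt_ne_zero'.2 (real_inner_self_pos.2 (hne i)))

omit [IsContMDiffRiemannianBundle 𝓘(ℝ, E₂) ∞ E₂ (fun p : M₂ ↦ TangentSpace 𝓘(ℝ, E₂) p)] in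
/-- Throughout the chart domain, `orthoFrame` is an orthonormal basis of the tangent space. -/
lemma exists_orthonormalBasis {x y : M₂} (hy : y ∈ (chartAt E₂ x).source) :
    ∃ b : OrthonormalBasis (Fin (Module.finrank ℝ E₂)) ℝ (TangentSpace 𝓘(ℝ, E₂) y),
      ∀ i, b i = orthoFrame x i y := by
  have ho : Orthonormal ℝ (fun i ↦ orthoFrame (E₂ := E₂) x i y) :=
    InnerProductSpace.gramSchmidtNormed_orthonormal (linearIndependent_coordField hy)
  refine ⟨OrthonormalBasis.mk ho (ho.linearIndependent.span_eq_top_of_card_eq_finrank' ?_).ge,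
    fun i ↦ by simp⟩
  simp
  rfl

/-- A section along `F` is smooth as soon as its inner products with the coordinate fields are. -/
lemma smoothAt_of_inner (hF : ContMDiffAt 𝓘(ℝ, E₁) 𝓘(ℝ, E₂) ∞ F p) {x : M₂}
    (hx : F p ∈ (chartAt E₂ x).source)
    (h : ∀ i, ContMDiffAt 𝓘(ℝ, E₁) 𝓘(ℝ, ℝ) ∞ (fun q ↦ ⟪s q, coordField x i (F q)⟫_ℝ) p) :
    SmoothAt E₁ F s p := by
  -- pass to the orthonormal frame, in which inner products are components
  have h2 : ∀ i, ContMDiffAt 𝓘(ℝ, E₁) 𝓘(ℝ, ℝ) ∞ (fun q ↦ ⟪orthoFrame x i (F q), s q⟫_ℝ) p := by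
    intro i
    have hsm := (smoothAt_orthoFrame hx i).comp hF
    have : ContMDiffAt 𝓘(ℝ, E₁) 𝓘(ℝ, ℝ) ∞ (fun q ↦ ∑ j,
        chartComp x (orthoFrame x i (F q)) j * ⟪s q, coordField x j (F q)⟫_ℝ) p :=
      contMDiffAt_finsetSum fun j _ ↦ (hsm.contMDiffAt_chartComp hx j).mul (h j)
    refine this.congr_of_eventuallyEq ?_
    filter_upwards [eventually_mem_chart hF hx] with q hq
    conv_lhs => rw [← sum_chartComp_smul_coordField hq (orthoFrame x i (F q))]
    simp_rw [sum_inner, real_inner_smul_left, real_inner_comm (s q)]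
  refine (SmoothAt.sum Finset.univ hF fun i _ ↦
    SmoothAt.smul (h2 i) ((smoothAt_orthoFrame hx i).comp hF)).congr ?_
  filter_upwards [eventually_mem_chart hF hx] with q hq
  obtain ⟨b, hb⟩ := exists_orthonormalBasis (E₂ := E₂) hq
  simp_rw [← hb]
  exact (b.sum_repr' (s q)).symm

end Frames

/-! ### The pullback connection -/

section Connection

variable {E₁ : Type*} [NormedAddCommGroup E₁] [NormedSpace ℝ E₁]
  {M₁ : Type*} [TopologicalSpace M₁] [ChartedSpace E₁ M₁]
  {E₂ : Type*} [NormedAddCommGroup E₂] [NormedSpace ℝ E₂] [FiniteDimensional ℝ E₂]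
  {M₂ : Type*} [TopologicalSpace M₂] [ChartedSpace E₂ M₂] [IsManifold 𝓘(ℝ, E₂) ∞ M₂]
  [RiemannianBundle (fun p : M₂ ↦ TangentSpace 𝓘(ℝ, E₂) p)]
  [IsContMDiffRiemannianBundle 𝓘(ℝ, E₂) ∞ E₂ (fun p : M₂ ↦ TangentSpace 𝓘(ℝ, E₂) p)]
  {F : M₁ → M₂} {s t : ∀ q, TangentSpace 𝓘(ℝ, E₂) (F q)} {p : M₁}

lemma _root_.ContMDiffAt.mdiff {E' : Type*} [NormedAddCommGroup E'] [NormedSpace ℝ E'] {f : M₁ → E'}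
    (hf : ContMDiffAt 𝓘(ℝ, E₁) 𝓘(ℝ, E') ∞ f p) : MDifferentiableAt 𝓘(ℝ, E₁) 𝓘(ℝ, E') f p :=
  hf.mdifferentiableAt (by simp)

/-- The derivative `x g(U, V)` of a component of the metric, with `U`, `V` the fields of constant
components in the preferred chart at `x` that extend `u`, `v`. -/
def metricDeriv {y : M₂} (x u v : TangentSpace 𝓘(ℝ, E₂) y) : ℝ :=
  mvfderiv 𝓘(ℝ, E₂) (fun q ↦ ⟪ext u q, ext v q⟫_ℝ) y x

lemma contMDiffAt_inner_ext {y : M₂} (u v : TangentSpace 𝓘(ℝ, E₂) y) :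
    ContMDiffAt 𝓘(ℝ, E₂) 𝓘(ℝ, ℝ) ∞ (fun q ↦ ⟪ext u q, ext v q⟫_ℝ) y :=
  (smoothAt_ext (mem_chart_source E₂ y) u).inner (smoothAt_ext (mem_chart_source E₂ y) v)

lemma metricDeriv_comm {y : M₂} (x u v : TangentSpace 𝓘(ℝ, E₂) y) :
    metricDeriv x u v = metricDeriv x v u := by
  simp only [metricDeriv, real_inner_comm]

lemma metricDeriv_add_left {y : M₂} (x x' u v : TangentSpace 𝓘(ℝ, E₂) y) :
    metricDeriv (x + x') u v = metricDeriv x u v + metricDeriv x' u v := map_add _ _ _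

lemma metricDeriv_smul_left {y : M₂} (c : ℝ) (x u v : TangentSpace 𝓘(ℝ, E₂) y) :
    metricDeriv (c • x) u v = c * metricDeriv x u v := map_smul _ _ _

lemma metricDeriv_add_mid {y : M₂} (x u u' v : TangentSpace 𝓘(ℝ, E₂) y) :
    metricDeriv x (u + u') v = metricDeriv x u v + metricDeriv x u' v := by
  have h : ∀ᶠ q in 𝓝 y,
      ⟪ext (u + u') q, ext v q⟫_ℝ = ⟪ext u q, ext v q⟫_ℝ + ⟪ext u' q, ext v q⟫_ℝ := by
    filter_upwards [(chartAt E₂ y).open_source.mem_nhds (mem_chart_source E₂ y)] with q hq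
    rw [ext_add hq, inner_add_left]
  unfold metricDeriv
  rw [mvfderiv_congr h, mvfderiv_fun_add (contMDiffAt_inner_ext u v).mdiff
    (contMDiffAt_inner_ext u' v).mdiff]
  rfl

lemma metricDeriv_smul_mid {y : M₂} (c : ℝ) (x u v : TangentSpace 𝓘(ℝ, E₂) y) :
    metricDeriv x (c • u) v = c * metricDeriv x u v := by
  have h : ∀ᶠ q in 𝓝 y, ⟪ext (c • u) q, ext v q⟫_ℝ = c * ⟪ext u q, ext v q⟫_ℝ := by
    filter_upwards [(chartAt E₂ y).open_source.mem_nhds (mem_chart_source E₂ y)] with q hq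
    rw [ext_smul hq, real_inner_smul_left]
  unfold metricDeriv
  rw [mvfderiv_congr h, mvfderiv_fun_mul mdifferentiableAt_const (contMDiffAt_inner_ext u v).mdiff,
    mvfderiv_const]
  simp

lemma metricDeriv_add_right {y : M₂} (x u v v' : TangentSpace 𝓘(ℝ, E₂) y) :
    metricDeriv x u (v + v') = metricDeriv x u v + metricDeriv x u v' := by
  rw [metricDeriv_comm, metricDeriv_add_mid, metricDeriv_comm x v, metricDeriv_comm x v']

lemma metricDeriv_smul_right {y : M₂} (c : ℝ) (x u v : TangentSpace 𝓘(ℝ, E₂) y) :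
    metricDeriv x u (c • v) = c * metricDeriv x u v := by
  rw [metricDeriv_comm, metricDeriv_smul_mid, metricDeriv_comm]

/-- The Koszul formula characterizing the Christoffel symbols. -/
lemma inner_christoffel (y : M₂) (u v w : TangentSpace 𝓘(ℝ, E₂) y) :
    ⟪christoffel y u v, w⟫_ℝ =
      (1 / 2 : ℝ) * (metricDeriv u v w + metricDeriv v u w - metricDeriv w u v) := by
  -- both sides are linear in `w`, and they agree on the basis that defines `christoffel`
  let L : TangentSpace 𝓘(ℝ, E₂) y →ₗ[ℝ] ℝ :=
    { toFun := fun w ↦ (1 / 2 : ℝ) * (metricDeriv u v w + metricDeriv v u w - metricDeriv w u v)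
      map_add' := fun a b ↦ by
        rw [metricDeriv_add_right, metricDeriv_add_right, metricDeriv_add_left]; ring
      map_smul' := fun c a ↦ by
        rw [metricDeriv_smul_right, metricDeriv_smul_right, metricDeriv_smul_left]
        simp only [RingHom.id_apply, smul_eq_mul]; ring }
  change _ = L w
  conv_rhs => rw [← (stdOrthonormalBasis ℝ (TangentSpace 𝓘(ℝ, E₂) y)).sum_repr' w]
  rw [map_sum]
  unfold christoffel
  rw [sum_inner]
  refine Finset.sum_congr rfl fun k _ ↦ ?_
  rw [real_inner_smul_left, map_smul, smul_eq_mul, mul_comm]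
  rfl

lemma christoffel_comm (y : M₂) (u v : TangentSpace 𝓘(ℝ, E₂) y) :
    christoffel y u v = christoffel y v u := by
  refine ext_inner_right ℝ fun w ↦ ?_
  rw [inner_christoffel, inner_christoffel, metricDeriv_comm w u v]; ring

lemma christoffel_add_left (y : M₂) (u u' v : TangentSpace 𝓘(ℝ, E₂) y) :
    christoffel y (u + u') v = christoffel y u v + christoffel y u' v := by
  refine ext_inner_right ℝ fun w ↦ ?_
  rw [inner_add_left, inner_christoffel, inner_christoffel, inner_christoffel,
    metricDeriv_add_left, metricDeriv_add_mid, metricDeriv_add_mid]; ring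

lemma christoffel_smul_left (y : M₂) (c : ℝ) (u v : TangentSpace 𝓘(ℝ, E₂) y) :
    christoffel y (c • u) v = c • christoffel y u v := by
  refine ext_inner_right ℝ fun w ↦ ?_
  rw [real_inner_smul_left, inner_christoffel, inner_christoffel,
    metricDeriv_smul_left, metricDeriv_smul_mid, metricDeriv_smul_mid]; ring

lemma christoffel_add_right (y : M₂) (u v v' : TangentSpace 𝓘(ℝ, E₂) y) :
    christoffel y u (v + v') = christoffel y u v + christoffel y u v' := by
  rw [christoffel_comm, christoffel_add_left, christoffel_comm y v, christoffel_comm y v']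

lemma christoffel_smul_right (y : M₂) (c : ℝ) (u v : TangentSpace 𝓘(ℝ, E₂) y) :
    christoffel y u (c • v) = c • christoffel y u v := by
  rw [christoffel_comm, christoffel_smul_left, christoffel_comm]

omit [IsContMDiffRiemannianBundle 𝓘(ℝ, E₂) ∞ E₂ (fun p : M₂ ↦ TangentSpace 𝓘(ℝ, E₂) p)] in
lemma covAlong_eq (x : TangentSpace 𝓘(ℝ, E₁) p) :
    covAlong F s p x =
      ofCoord (F p) (F p) (mvfderiv 𝓘(ℝ, E₁) (fun q ↦ coord (F p) (s q)) p x)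
        + christoffel (F p) (mfderiv 𝓘(ℝ, E₁) 𝓘(ℝ, E₂) F p x) (s p) := rfl

lemma covAlong_apply_add (s : ∀ q, TangentSpace 𝓘(ℝ, E₂) (F q))
    (x x' : TangentSpace 𝓘(ℝ, E₁) p) :
    covAlong F s p (x + x') = covAlong F s p x + covAlong F s p x' := by
  simp only [covAlong_eq, map_add, ofCoord_add (mem_chart_source E₂ (F p)), christoffel_add_left]
  abel

lemma covAlong_apply_smul (s : ∀ q, TangentSpace 𝓘(ℝ, E₂) (F q)) (c : ℝ)
    (x : TangentSpace 𝓘(ℝ, E₁) p) :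
    covAlong F s p (c • x) = c • covAlong F s p x := by
  simp only [covAlong_eq, map_smul, ofCoord_smul (mem_chart_source E₂ (F p)),
    christoffel_smul_left, smul_add]

omit [IsContMDiffRiemannianBundle 𝓘(ℝ, E₂) ∞ E₂ (fun p : M₂ ↦ TangentSpace 𝓘(ℝ, E₂) p)] in
lemma covAlong_congr (h : ∀ᶠ q in 𝓝 p, s q = t q) (x : TangentSpace 𝓘(ℝ, E₁) p) :
    covAlong F s p x = covAlong F t p x := by
  rw [covAlong_eq, covAlong_eq, h.self_of_nhds,
    mvfderiv_congr (h.mono fun q hq ↦ by rw [hq])]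

lemma covAlong_add (hs : SmoothAt E₁ F s p) (ht : SmoothAt E₁ F t p)
    (x : TangentSpace 𝓘(ℝ, E₁) p) :
    covAlong F (fun q ↦ s q + t q) p x = covAlong F s p x + covAlong F t p x := by
  have hx := mem_chart_source E₂ (F p)
  have h : ∀ᶠ q in 𝓝 p, coord (F p) (s q + t q) = coord (F p) (s q) + coord (F p) (t q) :=
    (eventually_mem_chart hs.base hx).mono fun q hq ↦ coord_add hq _ _
  rw [covAlong_eq, covAlong_eq, covAlong_eq, mvfderiv_congr h,
    mvfderiv_fun_add (hs.coord hx).mdiff (ht.coord hx).mdiff, christoffel_add_right]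
  simp only [add_apply, ofCoord_add hx]
  abel

lemma covAlong_smul {f : M₁ → ℝ} (hf : ContMDiffAt 𝓘(ℝ, E₁) 𝓘(ℝ, ℝ) ∞ f p)
    (hs : SmoothAt E₁ F s p) (x : TangentSpace 𝓘(ℝ, E₁) p) :
    covAlong F (fun q ↦ f q • s q) p x =
      mvfderiv 𝓘(ℝ, E₁) f p x • s p + f p • covAlong F s p x := by
  have hx := mem_chart_source E₂ (F p)
  have h : ∀ᶠ q in 𝓝 p, coord (F p) (f q • s q) = f q • coord (F p) (s q) :=
    (eventually_mem_chart hs.base hx).mono fun q hq ↦ coord_smul hq _ _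
  rw [covAlong_eq, covAlong_eq, mvfderiv_congr h,
    mvfderiv_fun_smul hf.mdiff (hs.coord hx).mdiff, christoffel_smul_right]
  simp only [add_apply, smul_apply,
    ContinuousLinearMap.smulRight_apply, ofCoord_add hx, ofCoord_smul hx, ofCoord_coord hx, smul_add]
  abel

lemma covAlong_zero (hF : ContMDiffAt 𝓘(ℝ, E₁) 𝓘(ℝ, E₂) ∞ F p) (x : TangentSpace 𝓘(ℝ, E₁) p) :
    covAlong F (fun q ↦ (0 : TangentSpace 𝓘(ℝ, E₂) (F q))) p x = 0 := by
  have h := covAlong_add (smoothAt_zero hF) (smoothAt_zero hF) x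
  simpa using h

lemma covAlong_const_smul (c : ℝ) (hs : SmoothAt E₁ F s p) (x : TangentSpace 𝓘(ℝ, E₁) p) :
    covAlong F (fun q ↦ c • s q) p x = c • covAlong F s p x := by
  rw [covAlong_smul (f := fun _ ↦ c) contMDiffAt_const hs, mvfderiv_const]
  simp

lemma covAlong_neg (hs : SmoothAt E₁ F s p) (x : TangentSpace 𝓘(ℝ, E₁) p) :
    covAlong F (fun q ↦ -s q) p x = -covAlong F s p x := by
  rw [← neg_one_smul ℝ (covAlong F s p x), ← covAlong_const_smul _ hs]
  simp only [neg_smul, one_smul]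

lemma covAlong_sum {ι : Type*} (J : Finset ι) {s : ι → ∀ q, TangentSpace 𝓘(ℝ, E₂) (F q)}
    (hF : ContMDiffAt 𝓘(ℝ, E₁) 𝓘(ℝ, E₂) ∞ F p) (hs : ∀ i ∈ J, SmoothAt E₁ F (s i) p)
    (x : TangentSpace 𝓘(ℝ, E₁) p) :
    covAlong F (fun q ↦ ∑ i ∈ J, s i q) p x = ∑ i ∈ J, covAlong F (s i) p x := by
  classical
  induction J using Finset.induction_on with
  | empty => simpa using covAlong_zero hF x
  | insert i J hi ih =>
    have hJ : ∀ j ∈ J, SmoothAt E₁ F (s j) p := fun j hj ↦ hs j (by simp [hj])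
    simp only [Finset.sum_insert hi]
    rw [covAlong_add (hs i (by simp)) (SmoothAt.sum J hF hJ), ih hJ]

omit [IsContMDiffRiemannianBundle 𝓘(ℝ, E₂) ∞ E₂ (fun p : M₂ ↦ TangentSpace 𝓘(ℝ, E₂) p)] in
/-- The chain rule for restrictions of vector fields of `M₂`. -/
lemma covAlong_comp {Y : ∀ y : M₂, TangentSpace 𝓘(ℝ, E₂) y}
    (hF : ContMDiffAt 𝓘(ℝ, E₁) 𝓘(ℝ, E₂) ∞ F p) (hY : SmoothAt E₂ (fun y ↦ y) Y (F p))
    (x : TangentSpace 𝓘(ℝ, E₁) p) :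
    covAlong F (fun q ↦ Y (F q)) p x =
      leviCivita Y (F p) (mfderiv 𝓘(ℝ, E₁) 𝓘(ℝ, E₂) F p x) := by
  have hx := mem_chart_source E₂ (F p)
  have h := mfderiv_comp_apply p (g := fun y ↦ coord (F p) (Y y)) (f := F)
    (hY.coord hx).mdiff (hF.mdifferentiableAt (by simp)) x
  have h2 : mfderiv 𝓘(ℝ, E₂) 𝓘(ℝ, E₂) (fun y : M₂ ↦ y) (F p) = ContinuousLinearMap.id ℝ _ :=
    mfderiv_id
  rw [leviCivita, covAlong_eq, covAlong_eq, h2]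
  congr 2

/-- Compatibility of the pullback connection with the metric. -/
lemma mvfderiv_inner (hs : SmoothAt E₁ F s p) (ht : SmoothAt E₁ F t p)
    (x : TangentSpace 𝓘(ℝ, E₁) p) :
    mvfderiv 𝓘(ℝ, E₁) (fun q ↦ ⟪s q, t q⟫_ℝ) p x =
      ⟪covAlong F s p x, t p⟫_ℝ + ⟪s p, covAlong F t p x⟫_ℝ := by
  have hF := hs.base
  have hx := mem_chart_source E₂ (F p)
  -- both sides are additive and satisfy the Leibniz rule in `s` and in `t`: take coordinate fields
  refine SmoothAt.induction (P := fun s ↦ mvfderiv 𝓘(ℝ, E₁) (fun q ↦ ⟪s q, t q⟫_ℝ) p x =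
      ⟪covAlong F s p x, t p⟫_ℝ + ⟪s p, covAlong F t p x⟫_ℝ) hF ?_ ?_ ?_ ?_ ?_ s hs
  · intro s s' hs h ih
    rw [mvfderiv_congr (h.mono fun q hq ↦ by rw [hq]), ih, h.self_of_nhds, covAlong_congr h]
  · simp only [inner_zero_left, mvfderiv_const, covAlong_zero hF]
    simp
  · intro s s' hs hs' ih ih'
    simp only [inner_add_left]
    rw [mvfderiv_fun_add (hs.inner ht).mdiff (hs'.inner ht).mdiff, covAlong_add hs hs',
      add_apply, ih, ih', inner_add_left]
    ring
  · intro f s hf hs ih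
    simp only [real_inner_smul_left]
    rw [mvfderiv_fun_mul hf.mdiff (hs.inner ht).mdiff, covAlong_smul hf hs,
      add_apply, smul_apply, ih]
    simp only [inner_add_left, real_inner_smul_left, smul_apply, smul_eq_mul]
    ring
  intro i
  have hi := (smoothAt_coordField hx i).comp hF
  refine SmoothAt.induction (P := fun t ↦ mvfderiv 𝓘(ℝ, E₁)
      (fun q ↦ ⟪coordField (F p) i (F q), t q⟫_ℝ) p x =
      ⟪covAlong F (fun q ↦ coordField (F p) i (F q)) p x, t p⟫_ℝ
        + ⟪coordField (F p) i (F p), covAlong F t p x⟫_ℝ) hF ?_ ?_ ?_ ?_ ?_ t ht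
  · intro s s' hs h ih
    rw [mvfderiv_congr (h.mono fun q hq ↦ by rw [hq]), ih, h.self_of_nhds, covAlong_congr h]
  · simp only [inner_zero_right, mvfderiv_const, covAlong_zero hF]
    simp
  · intro s s' hs hs' ih ih'
    simp only [inner_add_right]
    rw [mvfderiv_fun_add (hi.inner hs).mdiff (hi.inner hs').mdiff, covAlong_add hs hs',
      add_apply, ih, ih', inner_add_right]
    ring
  · intro f s hf hs ih
    simp only [real_inner_smul_right]
    rw [mvfderiv_fun_mul hf.mdiff (hi.inner hs).mdiff, covAlong_smul hf hs,
      add_apply, smul_apply, ih]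
    simp only [inner_add_right, real_inner_smul_right, smul_apply, smul_eq_mul]
    ring
  intro j
  -- in the chart at `F p`, coordinate fields are differentiated by the Christoffel symbol alone
  have hcov : ∀ k, covAlong F (fun q ↦ coordField (F p) k (F q)) p x =
      christoffel (F p) (mfderiv 𝓘(ℝ, E₁) 𝓘(ℝ, E₂) F p x) (coordField (F p) k (F p)) := by
    intro k
    have h : ∀ᶠ q in 𝓝 p, coord (F p) (coordField (F p) k (F q)) = Module.finBasis ℝ E₂ k :=
      (eventually_mem_chart hF hx).mono fun q hq ↦ coord_ofCoord (E₂ := E₂) hq _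
    rw [covAlong_eq, mvfderiv_congr h, mvfderiv_const]
    have h0 : ofCoord (F p) (F p) (0 : E₂) = (0 : TangentSpace 𝓘(ℝ, E₂) (F p)) := by
      simpa using ofCoord_smul (x := F p) hx (0 : ℝ) (0 : E₂)
    simp [h0]
  have hext : ∀ k, ext (coordField (E₂ := E₂) (F p) k (F p)) = coordField (F p) k := by
    intro k; funext y
    rw [ext_eq_ofCoord, coordField, coord_ofCoord hx]; rfl
  have hchain := mfderiv_comp_apply p
    (g := fun y : M₂ ↦ ⟪coordField (F p) i y, coordField (F p) j y⟫_ℝ) (f := F)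
    ((smoothAt_coordField hx i).inner (smoothAt_coordField hx j)).mdiff
    (hF.mdifferentiableAt (by simp)) x
  have hm : mvfderiv 𝓘(ℝ, E₁) (fun q ↦ ⟪coordField (F p) i (F q), coordField (F p) j (F q)⟫_ℝ) p x =
      metricDeriv (mfderiv 𝓘(ℝ, E₁) 𝓘(ℝ, E₂) F p x) (coordField (F p) i (F p))
        (coordField (F p) j (F p)) := by
    simp only [metricDeriv, hext]
    exact hchain
  rw [hm, hcov, hcov, real_inner_comm _ (coordField (F p) i (F p)), inner_christoffel,
    inner_christoffel, metricDeriv_comm _ (coordField (F p) j (F p)) (coordField (F p) i (F p)),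
    metricDeriv_comm (coordField (F p) j (F p)), metricDeriv_comm (coordField (F p) i (F p))]
  ring

end Connection

/-! ### Absence of torsion, and smoothness of covariant derivatives -/

section Smoothness

variable {E₁ : Type*} [NormedAddCommGroup E₁] [NormedSpace ℝ E₁] [FiniteDimensional ℝ E₁]
  {M₁ : Type*} [TopologicalSpace M₁] [ChartedSpace E₁ M₁] [IsManifold 𝓘(ℝ, E₁) ∞ M₁]
  {E₂ : Type*} [NormedAddCommGroup E₂] [NormedSpace ℝ E₂] [FiniteDimensional ℝ E₂]
  {M₂ : Type*} [TopologicalSpace M₂] [ChartedSpace E₂ M₂] [IsManifold 𝓘(ℝ, E₂) ∞ M₂]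
  [RiemannianBundle (fun p : M₂ ↦ TangentSpace 𝓘(ℝ, E₂) p)]
  [IsContMDiffRiemannianBundle 𝓘(ℝ, E₂) ∞ E₂ (fun p : M₂ ↦ TangentSpace 𝓘(ℝ, E₂) p)]
  {F : M₁ → M₂} {s t : ∀ q, TangentSpace 𝓘(ℝ, E₂) (F q)} {p : M₁}

/-- The pullback connection is torsion-free: on fields with constant components in a chart of `M₁`
(such fields commute), `∇^F_X F_*Y = ∇^F_Y F_*X`. -/
lemma covAlong_mfderiv_comm {x : M₁} (hp : p ∈ (chartAt E₁ x).source)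
    (hF : ∀ᶠ q in 𝓝 p, ContMDiffAt 𝓘(ℝ, E₁) 𝓘(ℝ, E₂) ∞ F q) (a b : E₁) :
    covAlong F (fun q ↦ mfderiv 𝓘(ℝ, E₁) 𝓘(ℝ, E₂) F q (ofCoord x q a)) p (ofCoord x p b) =
      covAlong F (fun q ↦ mfderiv 𝓘(ℝ, E₁) 𝓘(ℝ, E₂) F q (ofCoord x q b)) p (ofCoord x p a) := by
  have hFp := hF.self_of_nhds
  have hx := mem_chart_source E₂ (F p)
  let h : M₁ → E₂ := fun q ↦ extChartAt 𝓘(ℝ, E₂) (F p) (F q)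
  have hh : ContMDiffAt 𝓘(ℝ, E₁) 𝓘(ℝ, E₂) ∞ h p :=
    ContMDiffAt.comp p (contMDiffAt_extChartAt' hx) hFp
  have key : ∀ c : E₁, ∀ᶠ q in 𝓝 p,
      coord (F p) (mfderiv 𝓘(ℝ, E₁) 𝓘(ℝ, E₂) F q (ofCoord x q c)) =
        mvfderiv 𝓘(ℝ, E₁) h q (ofCoord x q c) := by
    intro c
    filter_upwards [eventually_mem_chart hFp hx, hF] with q hq hFq
    rw [coord_eq_mfderiv hq]
    exact (mfderiv_comp_apply q (g := extChartAt 𝓘(ℝ, E₂) (F p)) (f := F)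
      (mdifferentiableAt_extChartAt hq) (hFq.mdifferentiableAt (by simp)) (ofCoord x q c)).symm
  rw [covAlong_eq, covAlong_eq, mvfderiv_congr (key a), mvfderiv_congr (key b),
    mvfderiv_ofCoord_comm hp hh a b, christoffel_comm]

lemma leviCivita_eq_covAlong {Y : ∀ y : M₂, TangentSpace 𝓘(ℝ, E₂) y} (y : M₂)
    (v : TangentSpace 𝓘(ℝ, E₂) y) :
    leviCivita Y y v =
      covAlong (fun y : M₂ ↦ y)
        (fun y ↦ mfderiv 𝓘(ℝ, E₂) 𝓘(ℝ, E₂) (fun y : M₂ ↦ y) y (Y y)) y v := by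
  have h : ∀ y : M₂, mfderiv 𝓘(ℝ, E₂) 𝓘(ℝ, E₂) (fun y : M₂ ↦ y) y = ContinuousLinearMap.id ℝ _ :=
    fun _ ↦ mfderiv_id
  simp only [h]
  rfl

lemma leviCivita_ofCoord_comm {x y : M₂} (hy : y ∈ (chartAt E₂ x).source) (a b : E₂) :
    leviCivita (fun y ↦ ofCoord x y a) y (ofCoord x y b) =
      leviCivita (fun y ↦ ofCoord x y b) y (ofCoord x y a) := by
  rw [leviCivita_eq_covAlong, leviCivita_eq_covAlong]
  exact covAlong_mfderiv_comm hy (.of_forall fun _ ↦ contMDiffAt_id) a b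

/-- The Koszul formula for the coordinate fields of a chart. -/
lemma inner_leviCivita_coordField {x y : M₂} (hy : y ∈ (chartAt E₂ x).source)
    (i j k : Fin (Module.finrank ℝ E₂)) :
    ⟪leviCivita (coordField x j) y (coordField x i y), coordField x k y⟫_ℝ = (1 / 2 : ℝ) *
      (mvfderiv 𝓘(ℝ, E₂) (fun y : M₂ ↦ ⟪coordField x j y, coordField x k y⟫_ℝ) y (coordField x i y)
      + mvfderiv 𝓘(ℝ, E₂) (fun y : M₂ ↦ ⟪coordField x i y, coordField x k y⟫_ℝ) y (coordField x j y)
      - mvfderiv 𝓘(ℝ, E₂) (fun y : M₂ ↦ ⟪coordField x i y, coordField x j y⟫_ℝ) y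
          (coordField x k y)) := by
  have hs := fun i ↦ smoothAt_coordField hy i
  have hm : ∀ i j k,
      mvfderiv 𝓘(ℝ, E₂) (fun y : M₂ ↦ ⟪coordField x j y, coordField x k y⟫_ℝ) y (coordField x i y) =
      ⟪leviCivita (coordField x j) y (coordField x i y), coordField x k y⟫_ℝ
        + ⟪coordField x j y, leviCivita (coordField x k) y (coordField x i y)⟫_ℝ :=
    fun i j k ↦ mvfderiv_inner (hs j) (hs k) _
  have hc : ∀ i j, leviCivita (coordField x j) y (coordField x i y) =
      leviCivita (coordField x i) y (coordField x j y) :=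
    fun i j ↦ leviCivita_ofCoord_comm hy _ _
  rw [hm, hm, hm, hc j i, hc k i, hc k j, real_inner_comm _ (coordField x i y),
    real_inner_comm _ (coordField x j y)]
  ring

lemma smoothAt_leviCivita_coordField {x y : M₂} (hy : y ∈ (chartAt E₂ x).source)
    (i j : Fin (Module.finrank ℝ E₂)) :
    SmoothAt E₂ (fun y ↦ y) (fun y ↦ leviCivita (coordField x j) y (coordField x i y)) y := by
  have hs := fun i ↦ smoothAt_coordField hy i
  have hd : ∀ i j k, ContMDiffAt 𝓘(ℝ, E₂) 𝓘(ℝ, ℝ) ∞ (fun y ↦ mvfderiv 𝓘(ℝ, E₂)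
      (fun y : M₂ ↦ ⟪coordField x j y, coordField x k y⟫_ℝ) y (coordField x i y)) y :=
    fun i j k ↦ contMDiffAt_mvfderiv
      (f := fun y : M₂ ↦ ⟪coordField x j y, coordField x k y⟫_ℝ) ((hs j).inner (hs k)) (hs i)
  refine smoothAt_of_inner contMDiffAt_id hy fun k ↦ ?_
  refine ((contMDiffAt_const (c := (1 / 2 : ℝ))).mul
    (((hd i j k).add (hd j i k)).sub (hd k i j))).congr_of_eventuallyEq ?_
  filter_upwards [(chartAt E₂ x).open_source.mem_nhds hy] with z hz
  exact inner_leviCivita_coordField hz i j k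

lemma leviCivita_sum_smul {ι : Type*} (J : Finset ι) (Y : ∀ y : M₂, TangentSpace 𝓘(ℝ, E₂) y)
    (y : M₂) (c : ι → ℝ) (v : ι → TangentSpace 𝓘(ℝ, E₂) y) :
    leviCivita Y y (∑ i ∈ J, c i • v i) = ∑ i ∈ J, c i • leviCivita Y y (v i) := by
  let L : TangentSpace 𝓘(ℝ, E₂) y →ₗ[ℝ] TangentSpace 𝓘(ℝ, E₂) y :=
    { toFun := leviCivita Y y
      map_add' := covAlong_apply_add Y
      map_smul' := covAlong_apply_smul Y }
  change L _ = _
  rw [map_sum]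
  exact Finset.sum_congr rfl fun i _ ↦ map_smul L _ _

/-- Smoothness of `∇^F_X s` for smooth `X` and `s`. -/
lemma smoothAt_covAlong (hs : ∀ᶠ q in 𝓝 p, SmoothAt E₁ F s q)
    {X : ∀ q : M₁, TangentSpace 𝓘(ℝ, E₁) q} (hX : SmoothAt E₁ (fun q ↦ q) X p) :
    SmoothAt E₁ F (fun q ↦ covAlong F s q (X q)) p := by
  have hsp := hs.self_of_nhds
  have hF := hsp.base
  have hx := mem_chart_source E₂ (F p)
  -- `covAlong` at `q` is defined in the chart at `F q`; near `p` it is expanded in the fixed frame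
  -- of coordinate fields of the chart at `F p`, by the Leibniz rule and the chain rule
  have hexp : ∀ᶠ q in 𝓝 p, covAlong F s q (X q) = ∑ j,
      (mvfderiv 𝓘(ℝ, E₁) (fun q ↦ chartComp (F p) (s q) j) q (X q) • coordField (F p) j (F q)
        + chartComp (F p) (s q) j • ∑ i,
          chartComp (F p) (mfderiv 𝓘(ℝ, E₁) 𝓘(ℝ, E₂) F q (X q)) i •
            leviCivita (coordField (F p) j) (F q) (coordField (F p) i (F q))) := by
    filter_upwards [(eventually_mem_chart hF hx).eventually_nhds, hs] with q hq hsq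
    have hqx := hq.self_of_nhds
    rw [covAlong_congr (t := fun q ↦ ∑ j, chartComp (F p) (s q) j • coordField (F p) j (F q))
      (hq.mono fun q' hq' ↦ (sum_chartComp_smul_coordField hq' (s q')).symm)]
    have hcs := fun j ↦ hsq.contMDiffAt_chartComp hqx j
    have hfs := fun j ↦ smoothAt_coordField hqx j
    rw [covAlong_sum _ hsq.base fun j _ ↦ SmoothAt.smul (hcs j) ((hfs j).comp hsq.base)]
    refine Finset.sum_congr rfl fun j _ ↦ ?_
    rw [covAlong_smul (hcs j) ((hfs j).comp hsq.base), covAlong_comp hsq.base (hfs j),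
      ← leviCivita_sum_smul, sum_chartComp_smul_coordField hqx]
  refine SmoothAt.congr (SmoothAt.sum Finset.univ hF fun j _ ↦ ?_) hexp
  refine (SmoothAt.smul (contMDiffAt_mvfderiv (hsp.contMDiffAt_chartComp hx j) hX)
    ((smoothAt_coordField hx j).comp hF)).add
    (SmoothAt.smul (hsp.contMDiffAt_chartComp hx j) (SmoothAt.sum _ hF fun i _ ↦ ?_))
  exact SmoothAt.smul ((smoothAt_mfderiv hF hX).contMDiffAt_chartComp hx i)
    ((smoothAt_leviCivita_coordField hx i j).comp hF)

end Smoothness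

/-! ### Traces -/

section Trace

variable {V W ι : Type*} [NormedAddCommGroup V] [InnerProductSpace ℝ V] [FiniteDimensional ℝ V]
  [AddCommGroup W] [Module ℝ W] [Fintype ι]

/-- The trace over a subspace, computed in an arbitrary orthonormal basis of the whole space. -/
lemma traceOn_eq_sum (K : Submodule ℝ V) (B : V →ₗ[ℝ] V →ₗ[ℝ] W) (e : OrthonormalBasis ι ℝ V) :
    traceOn K (fun x y ↦ B x y) = ∑ i, B (K.starProjection (e i)) (e i) := by
  set f := stdOrthonormalBasis ℝ K
  have hP : ∀ v, K.starProjection v = ∑ k, ⟪(f k : V), v⟫_ℝ • (f k : V) := fun v ↦ by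
    rw [Submodule.starProjection_apply, ← f.sum_repr' (K.orthogonalProjectionOnto v)]
    simp only [Submodule.inner_orthogonalProjectionOnto_eq_of_mem_left, Submodule.coe_sum,
      Submodule.coe_smul]
  calc traceOn K (fun x y ↦ B x y) = ∑ k, B (f k) (f k) := rfl
    _ = ∑ k, B (f k) (∑ i, ⟪e i, (f k : V)⟫_ℝ • e i) := by simp_rw [e.sum_repr']
    _ = ∑ i, ∑ k, ⟪e i, (f k : V)⟫_ℝ • B (f k) (e i) := by
        rw [Finset.sum_comm]; simp
    _ = _ := by simp [hP, real_inner_comm]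

lemma trace_eq_sum (B : V →ₗ[ℝ] V →ₗ[ℝ] W) (e : OrthonormalBasis ι ℝ V) :
    trace (fun x y ↦ B x y) = ∑ i, B (e i) (e i) := by
  set f := stdOrthonormalBasis ℝ V
  calc trace (fun x y ↦ B x y) = ∑ k, B (f k) (f k) := rfl
    _ = ∑ k, B (f k) (∑ i, ⟪e i, f k⟫_ℝ • e i) := by simp_rw [e.sum_repr']
    _ = ∑ i, B (∑ k, ⟪f k, e i⟫_ℝ • f k) (e i) := by
        simp only [map_sum, map_smul, LinearMap.sum_apply, LinearMap.smul_apply]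
        rw [Finset.sum_comm]; simp [real_inner_comm]
    _ = _ := by simp_rw [f.sum_repr']

lemma traceOn_add_traceOn_orthogonal (K : Submodule ℝ V) (B : V →ₗ[ℝ] V →ₗ[ℝ] W) :
    traceOn K (fun x y ↦ B x y) + traceOn Kᗮ (fun x y ↦ B x y) = trace fun x y ↦ B x y := by
  set f := stdOrthonormalBasis ℝ V
  rw [traceOn_eq_sum K B f, traceOn_eq_sum Kᗮ B f, trace_eq_sum B f, ← Finset.sum_add_distrib]
  refine Finset.sum_congr rfl fun i _ ↦ ?_
  rw [← LinearMap.add_apply, ← map_add, Submodule.starProjection_add_starProjection_orthogonal]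

lemma traceOn_congr (K : Submodule ℝ V) {b b' : V → V → W}
    (h : ∀ x ∈ K, ∀ y ∈ K, b x y = b' x y) : traceOn K b = traceOn K b' := by
  unfold traceOn trace
  exact Finset.sum_congr rfl fun i _ ↦
    h _ (stdOrthonormalBasis ℝ K i).2 _ (stdOrthonormalBasis ℝ K i).2

lemma traceOn_mem {K : Submodule ℝ V} {b : V → V → W} {N : Submodule ℝ W}
    (h : ∀ x ∈ K, ∀ y ∈ K, b x y ∈ N) : traceOn K b ∈ N := by
  unfold traceOn trace
  exact N.sum_mem fun i _ ↦ h _ (stdOrthonormalBasis ℝ K i).2 _ (stdOrthonormalBasis ℝ K i).2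

/-- Over a subspace of dimension zero the trace vanishes, so that the junk value `0⁻¹ = 0` does no
harm. -/
lemma finrank_smul_inv_smul_traceOn {V W : Type*} [NormedAddCommGroup V] [InnerProductSpace ℝ V]
    [FiniteDimensional ℝ V] [AddCommGroup W] [Module ℝ W] (K : Submodule ℝ V) (b : V → V → W) :
    (Module.finrank ℝ K : ℝ) • (Module.finrank ℝ K : ℝ)⁻¹ • traceOn K b = traceOn K b := by
  by_cases h : Module.finrank ℝ K = 0
  · have : IsEmpty (Fin (Module.finrank ℝ K)) := by rw [h]; infer_instance
    have h0 : traceOn K b = 0 := by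
      unfold traceOn trace
      exact Finset.sum_of_isEmpty _
    simp [h0]
  · exact smul_inv_smul₀ (Nat.cast_ne_zero.2 h) _

lemma map_traceOn {V W W' : Type*} [NormedAddCommGroup V] [InnerProductSpace ℝ V]
    [FiniteDimensional ℝ V] [AddCommGroup W] [AddCommGroup W'] (L : W →+ W')
    (K : Submodule ℝ V) (b : V → V → W) :
    L (traceOn K b) = traceOn K fun x y ↦ L (b x y) := by
  unfold traceOn trace
  exact map_sum L _ _

end Trace

/-! ### The second fundamental form -/

section SecondFF

variable {E₁ : Type*} [NormedAddCommGroup E₁] [NormedSpace ℝ E₁] [FiniteDimensional ℝ E₁]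
  {M₁ : Type*} [TopologicalSpace M₁] [ChartedSpace E₁ M₁] [IsManifold 𝓘(ℝ, E₁) ∞ M₁]
  [RiemannianBundle (fun p : M₁ ↦ TangentSpace 𝓘(ℝ, E₁) p)]
  [IsContMDiffRiemannianBundle 𝓘(ℝ, E₁) ∞ E₁ (fun p : M₁ ↦ TangentSpace 𝓘(ℝ, E₁) p)]
  {E₂ : Type*} [NormedAddCommGroup E₂] [NormedSpace ℝ E₂] [FiniteDimensional ℝ E₂]
  {M₂ : Type*} [TopologicalSpace M₂] [ChartedSpace E₂ M₂] [IsManifold 𝓘(ℝ, E₂) ∞ M₂]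
  [RiemannianBundle (fun p : M₂ ↦ TangentSpace 𝓘(ℝ, E₂) p)]
  [IsContMDiffRiemannianBundle 𝓘(ℝ, E₂) ∞ E₂ (fun p : M₂ ↦ TangentSpace 𝓘(ℝ, E₂) p)]
  (F : C^∞⟮𝓘(ℝ, E₁), M₁; 𝓘(ℝ, E₂), M₂⟯) {p : M₁}

lemma smoothAt_d {Y : ∀ q : M₁, TangentSpace 𝓘(ℝ, E₁) q} (hY : SmoothAt E₁ (fun q ↦ q) Y p) :
    SmoothAt E₁ F (fun q ↦ d F q (Y q)) p :=
  smoothAt_mfderiv F.contMDiff.contMDiffAt hY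

/-- The expression `∇^F_x F_*(Y) - F_*(∇_x Y)` depends only on the value of `Y` at the point. -/
lemma secondFF_eq {Y : ∀ q : M₁, TangentSpace 𝓘(ℝ, E₁) q} (hY : SmoothAt E₁ (fun q ↦ q) Y p)
    (x : TangentSpace 𝓘(ℝ, E₁) p) :
    secondFF F p x (Y p) = covAlong F (fun q ↦ d F q (Y q)) p x - d F p (leviCivita Y p x) := by
  have hp := mem_chart_source E₁ p
  have hF : ContMDiffAt 𝓘(ℝ, E₁) 𝓘(ℝ, E₂) ∞ F p := F.contMDiff.contMDiffAt
  -- `Φ` is linear over smooth functions, so it sees only the components of `Y` at `p`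
  let Φ : (∀ q : M₁, TangentSpace 𝓘(ℝ, E₁) q) → TangentSpace 𝓘(ℝ, E₂) (F p) :=
    fun Y ↦ covAlong F (fun q ↦ d F q (Y q)) p x - d F p (leviCivita Y p x)
  have key : ∀ Y : ∀ q : M₁, TangentSpace 𝓘(ℝ, E₁) q, SmoothAt E₁ (fun q ↦ q) Y p →
      Φ Y = ∑ j, chartComp p (Y p) j • Φ (coordField p j) := by
    refine SmoothAt.induction (F := fun q : M₁ ↦ q)
      (P := fun Y ↦ Φ Y = ∑ j, chartComp p (Y p) j • Φ (coordField p j))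
      contMDiffAt_id ?_ ?_ ?_ ?_ ?_
    · intro s t hs h ih
      have h1 : Φ t = Φ s := by
        simp only [Φ]
        rw [covAlong_congr (h.mono fun q hq ↦ by rw [hq])]
        unfold leviCivita
        rw [covAlong_congr h]
      rw [h1, ih, h.self_of_nhds]
    · have h1 : ∀ j, chartComp p (0 : TangentSpace 𝓘(ℝ, E₁) p) j = 0 := fun j ↦ by
        simpa using chartComp_smul hp 0 (0 : TangentSpace 𝓘(ℝ, E₁) p) j
      simp only [Φ, h1, zero_smul, Finset.sum_const_zero, map_zero]
      unfold leviCivita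
      rw [covAlong_zero hF, covAlong_zero (F := fun q : M₁ ↦ q) contMDiffAt_id,
        map_zero, sub_zero]
    · intro s t hs ht ihs iht
      have h1 : Φ (fun q ↦ s q + t q) = Φ s + Φ t := by
        simp only [Φ, map_add]
        unfold leviCivita
        rw [covAlong_add (smoothAt_d F hs) (smoothAt_d F ht), covAlong_add hs ht, map_add]
        abel
      rw [h1, ihs, iht, ← Finset.sum_add_distrib]
      exact Finset.sum_congr rfl fun j _ ↦ by rw [chartComp_add hp, add_smul]
    · intro f s hf hs ih
      have h1 : Φ (fun q ↦ f q • s q) = f p • Φ s := by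
        simp only [Φ, map_smul]
        unfold leviCivita
        rw [covAlong_smul hf (smoothAt_d F hs), covAlong_smul hf hs, map_add, map_smul, map_smul,
          smul_sub]
        abel
      rw [h1, ih, Finset.smul_sum]
      exact Finset.sum_congr rfl fun j _ ↦ by rw [chartComp_smul hp, mul_smul]
    · intro i
      have h1 : ∀ j, chartComp p (coordField (E₂ := E₁) p i p) j = if i = j then 1 else 0 := by
        intro j
        rw [chartComp, coordField, coord_ofCoord hp, Module.Basis.repr_self, Finsupp.single_apply]
      simp [h1]
  have h2 := key (ext (Y p)) (smoothAt_ext hp _)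
  rw [ext_self, ← key Y hY] at h2
  exact h2

/-- Symmetry of `∇F_*`: both connections are torsion-free, and the fields `ext x` and `ext y`
commute. -/
lemma secondFF_comm (x y : TangentSpace 𝓘(ℝ, E₁) p) : secondFF F p x y = secondFF F p y x := by
  have hp := mem_chart_source E₁ p
  have h1 := covAlong_mfderiv_comm (F := F) hp (.of_forall fun q ↦ F.contMDiff.contMDiffAt)
    (coord p x) (coord p y)
  have h2 := leviCivita_ofCoord_comm (E₂ := E₁) hp (coord p x) (coord p y)
  rw [ofCoord_coord hp, ofCoord_coord hp] at h1 h2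
  unfold secondFF
  exact congrArg₂ (fun a b ↦ a - d F p b) h1.symm h2.symm

variable (p) in
/-- The second fundamental form as a bilinear map. -/
def secondFFHom : TangentSpace 𝓘(ℝ, E₁) p →ₗ[ℝ] TangentSpace 𝓘(ℝ, E₁) p →ₗ[ℝ]
    TangentSpace 𝓘(ℝ, E₂) (F p) :=
  have hadd : ∀ x x' y : TangentSpace 𝓘(ℝ, E₁) p,
      secondFF F p (x + x') y = secondFF F p x y + secondFF F p x' y := fun x x' y ↦ by
    simp only [secondFF, leviCivita]
    rw [covAlong_apply_add, covAlong_apply_add, map_add]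
    abel
  have hsmul : ∀ (c : ℝ) (x y : TangentSpace 𝓘(ℝ, E₁) p),
      secondFF F p (c • x) y = c • secondFF F p x y := fun c x y ↦ by
    simp only [secondFF, leviCivita]
    rw [covAlong_apply_smul, covAlong_apply_smul, map_smul, smul_sub]
  LinearMap.mk₂ ℝ (secondFF F p) hadd hsmul
    (fun x y y' ↦ by rw [secondFF_comm, hadd, secondFF_comm F y, secondFF_comm F y'])
    (fun c x y ↦ by rw [secondFF_comm, hsmul, secondFF_comm F y])

lemma secondFF_add_left (x x' y : TangentSpace 𝓘(ℝ, E₁) p) :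
    secondFF F p (x + x') y = secondFF F p x y + secondFF F p x' y :=
  (secondFFHom F p).map_add₂ x x' y

lemma smoothNear_secondFF {X Y : ∀ q : M₁, TangentSpace 𝓘(ℝ, E₁) q}
    (hX : ∀ᶠ q in 𝓝 p, SmoothAt E₁ (fun q ↦ q) X q)
    (hY : ∀ᶠ q in 𝓝 p, SmoothAt E₁ (fun q ↦ q) Y q) :
    ∀ᶠ q in 𝓝 p, SmoothAt E₁ F (fun q ↦ secondFF F q (X q) (Y q)) q := by
  filter_upwards [hX, hY.eventually_nhds] with q hXq hYq
  have h1 : SmoothAt E₁ F (fun q ↦ covAlong F (fun q ↦ d F q (Y q)) q (X q)) q :=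
    smoothAt_covAlong (hYq.mono fun q' h ↦ smoothAt_d F h) hXq
  have h2 : SmoothAt E₁ F (fun q ↦ d F q (leviCivita Y q (X q))) q :=
    smoothAt_d F (smoothAt_covAlong hYq hXq)
  exact (h1.sub h2).congr (hYq.mono fun q' h ↦ secondFF_eq F h (X q'))

lemma inner_adj (w : TangentSpace 𝓘(ℝ, E₂) (F p)) (x : TangentSpace 𝓘(ℝ, E₁) p) :
    ⟪adj F p w, x⟫_ℝ = ⟪w, d F p x⟫_ℝ :=
  LinearMap.adjoint_inner_left _ _ _

lemma smoothAt_adj {s : ∀ q, TangentSpace 𝓘(ℝ, E₂) (F q)} (hs : SmoothAt E₁ F s p) :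
    SmoothAt E₁ (fun q ↦ q) (fun q ↦ adj F q (s q)) p := by
  refine smoothAt_of_inner contMDiffAt_id (mem_chart_source E₁ p) fun i ↦ ?_
  simp only [inner_adj]
  exact hs.inner (smoothAt_d F (smoothAt_coordField (mem_chart_source E₁ p) i))

end SecondFF

/-! ### Riemannian maps -/

section RiemannianMap

variable {E₁ : Type*} [NormedAddCommGroup E₁] [NormedSpace ℝ E₁] [FiniteDimensional ℝ E₁]
  {M₁ : Type*} [TopologicalSpace M₁] [ChartedSpace E₁ M₁] [IsManifold 𝓘(ℝ, E₁) ∞ M₁]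
  [RiemannianBundle (fun p : M₁ ↦ TangentSpace 𝓘(ℝ, E₁) p)]
  [IsContMDiffRiemannianBundle 𝓘(ℝ, E₁) ∞ E₁ (fun p : M₁ ↦ TangentSpace 𝓘(ℝ, E₁) p)]
  {E₂ : Type*} [NormedAddCommGroup E₂] [NormedSpace ℝ E₂] [FiniteDimensional ℝ E₂]
  {M₂ : Type*} [TopologicalSpace M₂] [ChartedSpace E₂ M₂] [IsManifold 𝓘(ℝ, E₂) ∞ M₂]
  [RiemannianBundle (fun p : M₂ ↦ TangentSpace 𝓘(ℝ, E₂) p)]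
  [IsContMDiffRiemannianBundle 𝓘(ℝ, E₂) ∞ E₂ (fun p : M₂ ↦ TangentSpace 𝓘(ℝ, E₂) p)]
  {F : C^∞⟮𝓘(ℝ, E₁), M₁; 𝓘(ℝ, E₂), M₂⟯} {p : M₁}

lemma d_vert (x : TangentSpace 𝓘(ℝ, E₁) p) : d F p (vert F p x) = 0 :=
  (ker F p).starProjection_apply_mem x

lemma vert_add_hor (x : TangentSpace 𝓘(ℝ, E₁) p) : vert F p x + hor F p x = x :=
  Submodule.starProjection_add_starProjection_orthogonal x

lemma d_hor (x : TangentSpace 𝓘(ℝ, E₁) p) : d F p (hor F p x) = d F p x := by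
  conv_rhs => rw [← vert_add_hor (F := F) x, map_add, d_vert, zero_add]

lemma hor_mem (x : TangentSpace 𝓘(ℝ, E₁) p) : hor F p x ∈ (ker F p)ᗮ :=
  (ker F p)ᗮ.starProjection_apply_mem x

lemma hor_eq_self {x : TangentSpace 𝓘(ℝ, E₁) p} (hx : x ∈ (ker F p)ᗮ) : hor F p x = x :=
  Submodule.starProjection_eq_self_iff.2 hx

lemma vert_eq_self {x : TangentSpace 𝓘(ℝ, E₁) p} (hx : x ∈ ker F p) : vert F p x = x :=
  Submodule.starProjection_eq_self_iff.2 hx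

lemma inner_hor_left (x y : TangentSpace 𝓘(ℝ, E₁) p) :
    ⟪hor F p x, y⟫_ℝ = ⟪x, hor F p y⟫_ℝ :=
  Submodule.inner_starProjection_left_eq_right _ x y

lemma hor_adj (w : TangentSpace 𝓘(ℝ, E₂) (F p)) : hor F p (adj F p w) = adj F p w := by
  refine ext_inner_right ℝ fun z ↦ ?_
  rw [inner_hor_left, inner_adj, inner_adj, d_hor]

lemma tang_add_nor (w : TangentSpace 𝓘(ℝ, E₂) (F p)) : tang F p w + nor F p w = w :=
  Submodule.starProjection_add_starProjection_orthogonal w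

lemma d_mem_range (x : TangentSpace 𝓘(ℝ, E₁) p) : d F p x ∈ range F p := ⟨x, rfl⟩

lemma mem_range_orthogonal {w : TangentSpace 𝓘(ℝ, E₂) (F p)} :
    w ∈ (range F p)ᗮ ↔ ∀ z, ⟪w, d F p z⟫_ℝ = 0 := by
  rw [Submodule.mem_orthogonal']
  constructor
  · exact fun h z ↦ h _ (d_mem_range z)
  · rintro h _ ⟨z, rfl⟩
    exact h z

lemma tang_mem (w : TangentSpace 𝓘(ℝ, E₂) (F p)) : tang F p w ∈ range F p :=
  (range F p).starProjection_apply_mem w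

lemma nor_mem (w : TangentSpace 𝓘(ℝ, E₂) (F p)) : nor F p w ∈ (range F p)ᗮ :=
  (range F p)ᗮ.starProjection_apply_mem w

lemma tang_eq_self {w : TangentSpace 𝓘(ℝ, E₂) (F p)} (hw : w ∈ range F p) : tang F p w = w :=
  Submodule.starProjection_eq_self_iff.2 hw

lemma nor_eq_self {w : TangentSpace 𝓘(ℝ, E₂) (F p)} (hw : w ∈ (range F p)ᗮ) : nor F p w = w :=
  Submodule.starProjection_eq_self_iff.2 hw

lemma tang_eq_zero {w : TangentSpace 𝓘(ℝ, E₂) (F p)} (hw : w ∈ (range F p)ᗮ) :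
    tang F p w = 0 := by
  have h := tang_add_nor w
  rwa [nor_eq_self hw, add_eq_right] at h

lemma nor_eq_zero {w : TangentSpace 𝓘(ℝ, E₂) (F p)} (hw : w ∈ range F p) :
    nor F p w = 0 := by
  have h := tang_add_nor w
  rwa [tang_eq_self hw, add_eq_left] at h

lemma adj_eq_zero {w : TangentSpace 𝓘(ℝ, E₂) (F p)} (hw : w ∈ (range F p)ᗮ) :
    adj F p w = 0 :=
  ext_inner_right ℝ fun z ↦ by rw [inner_adj, mem_range_orthogonal.1 hw, inner_zero_left]

lemma adj_tang (w : TangentSpace 𝓘(ℝ, E₂) (F p)) : adj F p (tang F p w) = adj F p w := by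
  conv_rhs => rw [← tang_add_nor w, map_add, adj_eq_zero (nor_mem w), add_zero]

lemma rank_eq_finrank_orthogonal : rank F p = Module.finrank ℝ (ker F p)ᗮ := by
  have h1 := (d F p).toLinearMap.finrank_range_add_finrank_ker
  have h2 := (ker F p).finrank_add_finrank_orthogonal
  unfold rank range
  unfold ker at h2 ⊢
  omega

lemma rank_add_dimKer : rank F p + dimKer F p = Module.finrank ℝ E₁ :=
  (d F p).toLinearMap.finrank_range_add_finrank_ker

/-- On vertical vectors the second fundamental form is tangent to the image: `F_*` kills the
vertical field that extends the vector. -/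
lemma secondFF_eq_neg_d {y : TangentSpace 𝓘(ℝ, E₁) p} (hy : y ∈ ker F p)
    (hs : SmoothAt E₁ (fun q ↦ q) (fun q ↦ vert F q (ext y q)) p) (x : TangentSpace 𝓘(ℝ, E₁) p) :
    secondFF F p x y = -d F p (leviCivita (fun q ↦ vert F q (ext y q)) p x) := by
  have h := secondFF_eq F hs x
  simp only [d_vert] at h
  rw [covAlong_zero F.contMDiff.contMDiffAt, zero_sub, ext_self, vert_eq_self hy] at h
  exact h

section

variable (hF : IsRiemannianMap F)
include hF

lemma inner_d (x y : TangentSpace 𝓘(ℝ, E₁) p) : ⟪d F p x, d F p y⟫_ℝ = ⟪hor F p x, y⟫_ℝ := by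
  rw [← d_hor x, ← d_hor y, hF p _ (hor_mem x) _ (hor_mem y), ← inner_hor_left,
    hor_eq_self (hor_mem x)]

lemma adj_d (x : TangentSpace 𝓘(ℝ, E₁) p) : adj F p (d F p x) = hor F p x :=
  ext_inner_right ℝ fun z ↦ by rw [inner_adj, inner_d hF]

lemma d_adj (w : TangentSpace 𝓘(ℝ, E₂) (F p)) : d F p (adj F p w) = tang F p w := by
  obtain ⟨x, hx⟩ := tang_mem w
  replace hx : d F p x = tang F p w := hx
  rw [← adj_tang, ← hx, adj_d hF, d_hor]

/-- `𝓗 = *F_* ∘ F_*` is a smooth projection, although `ker F_*` comes without a smooth frame. -/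
lemma smoothAt_hor {Y : ∀ q : M₁, TangentSpace 𝓘(ℝ, E₁) q} (hY : SmoothAt E₁ (fun q ↦ q) Y p) :
    SmoothAt E₁ (fun q ↦ q) (fun q ↦ hor F q (Y q)) p :=
  (smoothAt_adj F (smoothAt_d F hY)).congr (.of_forall fun q ↦ (adj_d hF (Y q)).symm)

lemma smoothAt_vert {Y : ∀ q : M₁, TangentSpace 𝓘(ℝ, E₁) q} (hY : SmoothAt E₁ (fun q ↦ q) Y p) :
    SmoothAt E₁ (fun q ↦ q) (fun q ↦ vert F q (Y q)) p :=
  (hY.sub (smoothAt_hor hF hY)).congr (.of_forall fun q ↦ eq_sub_of_add_eq (vert_add_hor (Y q)))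

lemma smoothAt_nor {s : ∀ q, TangentSpace 𝓘(ℝ, E₂) (F q)} (hs : SmoothAt E₁ F s p) :
    SmoothAt E₁ F (fun q ↦ nor F q (s q)) p :=
  (hs.sub (smoothAt_d F (smoothAt_adj F hs))).congr (.of_forall fun q ↦ by
    rw [d_adj hF]
    exact eq_sub_of_add_eq' (tang_add_nor (s q)))

/-- Derivative of the identity `⟪F_* Y, F_* Z⟫ = ⟪𝓗 Y, Z⟫`. -/
lemma inner_secondFF_add {Y : ∀ q : M₁, TangentSpace 𝓘(ℝ, E₁) q}
    (hY : SmoothAt E₁ (fun q ↦ q) Y p) (x z : TangentSpace 𝓘(ℝ, E₁) p) :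
    ⟪secondFF F p x (Y p), d F p z⟫_ℝ + ⟪secondFF F p x z, d F p (Y p)⟫_ℝ =
      ⟪leviCivita (fun q ↦ hor F q (Y q)) p x, z⟫_ℝ - ⟪leviCivita Y p x, hor F p z⟫_ℝ := by
  have hZ : SmoothAt E₁ (fun q ↦ q) (ext z) p := smoothAt_ext (mem_chart_source E₁ p) z
  have h1 := mvfderiv_inner (smoothAt_d F hY) (smoothAt_d F hZ) x
  have h2 := mvfderiv_inner (F := fun q : M₁ ↦ q) (smoothAt_hor hF hY) hZ x
  have h3 := mvfderiv_congr (p := p) (f := fun q ↦ ⟪d F q (Y q), d F q (ext z q)⟫_ℝ)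
    (g := fun q ↦ ⟪hor F q (Y q), ext z q⟫_ℝ) (.of_forall fun q ↦ inner_d hF _ _) x
  have h4 := secondFF_eq F hY x
  have h5 := secondFF_eq F hZ x
  have h6 : ⟪d F p (leviCivita Y p x), d F p z⟫_ℝ = ⟪leviCivita Y p x, hor F p z⟫_ℝ := by
    rw [inner_d hF, inner_hor_left]
  have h7 : ⟪d F p (leviCivita (ext z) p x), d F p (Y p)⟫_ℝ =
      ⟪hor F p (Y p), leviCivita (ext z) p x⟫_ℝ := by
    rw [real_inner_comm, inner_d hF]
  simp only [ext_self] at h1 h2 h5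
  rw [h4, h5, inner_sub_left, inner_sub_left, h6, h7]
  unfold leviCivita at *
  rw [real_inner_comm (d F p (Y p))]
  linarith

lemma inner_secondFF_skew (x : TangentSpace 𝓘(ℝ, E₁) p) {y z : TangentSpace 𝓘(ℝ, E₁) p}
    (hy : y ∈ (ker F p)ᗮ) (hz : z ∈ (ker F p)ᗮ) :
    ⟪secondFF F p x y, d F p z⟫_ℝ + ⟪secondFF F p x z, d F p y⟫_ℝ = 0 := by
  have h := inner_secondFF_add hF (smoothAt_hor hF (smoothAt_ext (mem_chart_source E₁ p) y)) x z
  simp only [ext_self, hor_eq_self (hor_mem _), hor_eq_self hy, hor_eq_self hz, sub_self] at h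
  exact h

/-- The second fundamental form of a Riemannian map is normal to the image on horizontal vectors:
`⟪(∇F_*)(x, y), F_* z⟫` is symmetric in `x, y` and skew in `y, z`. -/
lemma secondFF_mem_orthogonal {x y : TangentSpace 𝓘(ℝ, E₁) p}
    (hx : x ∈ (ker F p)ᗮ) (hy : y ∈ (ker F p)ᗮ) : secondFF F p x y ∈ (range F p)ᗮ := by
  refine mem_range_orthogonal.2 fun z ↦ ?_
  rw [← d_hor z]
  have hz := hor_mem (F := F) z
  have h1 := inner_secondFF_skew hF x hy hz
  have h2 := inner_secondFF_skew hF y hx hz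
  have h3 := inner_secondFF_skew hF (hor F p z) hx hy
  rw [secondFF_comm F y x] at h2
  rw [secondFF_comm F _ x, secondFF_comm F _ y] at h3
  linarith

/-- The field `μ` in terms of `∇F_*`: on vertical vectors `(∇F_*)(x, y) = -F_*(∇_x 𝓥Y)`. -/
lemma kerMean_eq (q : M₁) : kerMean F q =
    -((dimKer F q : ℝ)⁻¹ • adj F q (traceOn (ker F q) (secondFF F q))) := by
  set X := traceOn (ker F q) fun x y ↦ hor F q (leviCivita (fun q ↦ vert F q (ext y q)) q x)
  have hX : X ∈ (ker F q)ᗮ := traceOn_mem fun x _ y _ ↦ hor_mem _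
  have hd : d F q X = -traceOn (ker F q) (secondFF F q) := by
    have h1 := map_traceOn (d F q).toLinearMap.toAddMonoidHom (ker F q) fun x y ↦
      hor F q (leviCivita (fun q ↦ vert F q (ext y q)) q x)
    have h2 := map_traceOn (negAddMonoidHom) (ker F q) (secondFF F q)
    refine h1.trans (Eq.trans (traceOn_congr _ fun x _ y hy ↦ ?_) h2.symm)
    refine (d_hor _).trans ?_
    rw [negAddMonoidHom_apply, secondFF_eq_neg_d hy
      (smoothAt_vert hF (smoothAt_ext (mem_chart_source E₁ q) y)), neg_neg]
  have h3 : X = -adj F q (traceOn (ker F q) (secondFF F q)) := by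
    rw [← map_neg, ← hd, adj_d hF, hor_eq_self hX]
  unfold kerMean
  rw [← smul_neg, ← h3]

/-- The field `H₂` in terms of `∇F_*`, which is normal on horizontal vectors and differs from
`∇^F_x F_* Y` by a tangential term. -/
lemma rangeMean_eq (q : M₁) : rangeMean F q =
    (rank F q : ℝ)⁻¹ • traceOn (ker F q)ᗮ (secondFF F q) := by
  unfold rangeMean
  congr 1
  refine traceOn_congr _ fun x hx y hy ↦ ?_
  have h : covAlong F (fun q ↦ d F q (ext y q)) q x =
      secondFF F q x y + d F q (leviCivita (ext y) q x) := (sub_add_cancel _ _).symm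
  have h2 : ∀ a b, nor F q (a + b) = nor F q a + nor F q b := map_add _
  rw [h, h2, nor_eq_zero (d_mem_range _), add_zero, nor_eq_self (secondFF_mem_orthogonal hF hx hy)]

lemma kerMean_mem (q : M₁) : kerMean F q ∈ (ker F q)ᗮ :=
  Submodule.smul_mem _ _ (traceOn_mem fun _ _ _ _ ↦ hor_mem _)

lemma rangeMean_mem (q : M₁) : rangeMean F q ∈ (range F q)ᗮ :=
  Submodule.smul_mem _ _ (traceOn_mem fun _ _ _ _ ↦ nor_mem _)

/-- The tension field splits into its tangential part `-m₁ F_* μ` and its normal part `m₂ H₂`. -/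
lemma tension_eq (q : M₁) : tension F q =
    -((dimKer F q : ℝ) • d F q (kerMean F q)) + (rank F q : ℝ) • rangeMean F q := by
  have h1 : (dimKer F q : ℝ) • kerMean F q = -adj F q (traceOn (ker F q) (secondFF F q)) := by
    have h := finrank_smul_inv_smul_traceOn (ker F q) (secondFF F q)
    rw [kerMean_eq hF, smul_neg, ← map_smul, ← map_smul]
    exact congrArg (fun a ↦ -adj F q a) h
  have h2 : (rank F q : ℝ) • rangeMean F q = traceOn (ker F q)ᗮ (secondFF F q) := by
    rw [rangeMean_eq hF, rank_eq_finrank_orthogonal]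
    exact finrank_smul_inv_smul_traceOn (ker F q)ᗮ (secondFF F q)
  have h3 : traceOn (ker F q) (secondFF F q) ∈ range F q := traceOn_mem fun x _ y hy ↦ by
    rw [secondFF_eq_neg_d hy (smoothAt_vert hF (smoothAt_ext (mem_chart_source E₁ q) y))]
    exact Submodule.neg_mem _ (d_mem_range _)
  rw [← map_smul, h1, h2, map_neg, neg_neg, d_adj hF, tang_eq_self h3]
  exact (traceOn_add_traceOn_orthogonal (ker F q) (secondFFHom F q)).symm

/-- The rank of a Riemannian map is `∑ i, ⟪F_* e i, F_* e i⟫` over any orthonormal basis. -/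
lemma rank_eq_sum {ι : Type*} [Fintype ι] (q : M₁)
    (e : OrthonormalBasis ι ℝ (TangentSpace 𝓘(ℝ, E₁) q)) :
    (rank F q : ℝ) = ∑ i, ⟪d F q (e i), d F q (e i)⟫_ℝ := by
  have h1 := traceOn_eq_sum (ker F q)ᗮ (innerₗ (TangentSpace 𝓘(ℝ, E₁) q)) e
  have h2 : traceOn (ker F q)ᗮ (fun x y ↦ innerₗ (TangentSpace 𝓘(ℝ, E₁) q) x y) =
      (rank F q : ℝ) := by
    rw [rank_eq_finrank_orthogonal]
    unfold traceOn trace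
    have : ∀ i, innerₗ (TangentSpace 𝓘(ℝ, E₁) q) (stdOrthonormalBasis ℝ (ker F q)ᗮ i)
        (stdOrthonormalBasis ℝ (ker F q)ᗮ i) = 1 := fun i ↦ by
      rw [innerₗ_apply_apply, ← Submodule.coe_inner, real_inner_self_eq_norm_sq,
        OrthonormalBasis.norm_eq_one, one_pow]
    simp only [this, Finset.sum_const, Finset.card_univ, Fintype.card_fin, nsmul_eq_mul, mul_one]
  rw [← h2, h1]
  exact Finset.sum_congr rfl fun i _ ↦ (inner_d hF _ _).symm

/-- The rank of a Riemannian map is locally constant: it is an integer, and it is the value of the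
continuous function of `rank_eq_sum` for a smooth orthonormal frame. -/
lemma eventually_rank_eq (p : M₁) : ∀ᶠ q in 𝓝 p, rank F q = rank F p := by
  have hp := mem_chart_source E₁ p
  have hc : ContinuousAt (fun q ↦ ∑ i, ⟪d F q (orthoFrame p i q), d F q (orthoFrame p i q)⟫_ℝ) p :=
    (contMDiffAt_finsetSum fun i _ ↦ (smoothAt_d F (smoothAt_orthoFrame hp i)).inner
      (smoothAt_d F (smoothAt_orthoFrame hp i))).continuousAt
  have he : ∀ q ∈ (chartAt E₁ p).source, (rank F q : ℝ) =
      ∑ i, ⟪d F q (orthoFrame p i q), d F q (orthoFrame p i q)⟫_ℝ := fun q hq ↦ by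
    obtain ⟨b, hb⟩ := exists_orthonormalBasis (E₂ := E₁) hq
    rw [rank_eq_sum hF q b]
    simp_rw [hb]
  filter_upwards [(chartAt E₁ p).open_source.mem_nhds hp,
    hc.eventually (Metric.ball_mem_nhds _ one_pos)] with q hq hq'
  rw [← he q hq, ← he p hp, Nat.dist_cast_real, Nat.dist_eq] at hq'
  have h2 : |(rank F q : ℤ) - rank F p| < 1 := by exact_mod_cast hq'
  rw [Int.abs_lt_one_iff] at h2
  omega

lemma eventually_dimKer_eq (p : M₁) : ∀ᶠ q in 𝓝 p, dimKer F q = dimKer F p := by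
  filter_upwards [eventually_rank_eq hF p] with q hq
  have h1 := rank_add_dimKer (F := F) (p := q)
  have h2 := rank_add_dimKer (F := F) (p := p)
  omega

/-- The traces over `ker F_*` and its complement are smooth, since a smooth frame of `TM₁` serves to
compute them (`traceOn_eq_sum`). -/
lemma smoothAt_traceOn_ker (p : M₁) :
    SmoothAt E₁ F (fun q ↦ traceOn (ker F q) (secondFF F q)) p := by
  have hp := mem_chart_source E₁ p
  refine (SmoothAt.sum
    (s := fun i q ↦ secondFF F q (vert F q (orthoFrame p i q)) (orthoFrame p i q))
    Finset.univ F.contMDiff.contMDiffAt fun i _ ↦ ?_).congr ?_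
  · have h : ∀ᶠ q in 𝓝 p, SmoothAt E₁ (fun q ↦ q) (orthoFrame p i) q :=
      Filter.mem_of_superset ((chartAt E₁ p).open_source.mem_nhds hp)
        fun q hq ↦ smoothAt_orthoFrame hq i
    exact (smoothNear_secondFF F (h.mono fun q hq ↦ smoothAt_vert hF hq) h).self_of_nhds
  · filter_upwards [(chartAt E₁ p).open_source.mem_nhds hp] with q hq
    obtain ⟨b, hb⟩ := exists_orthonormalBasis (E₂ := E₁) hq
    simp_rw [← hb]
    exact traceOn_eq_sum (ker F q) (secondFFHom F q) b

lemma smoothAt_traceOn_ker_orthogonal (p : M₁) :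
    SmoothAt E₁ F (fun q ↦ traceOn (ker F q)ᗮ (secondFF F q)) p := by
  have hp := mem_chart_source E₁ p
  refine (SmoothAt.sum
    (s := fun i q ↦ secondFF F q (hor F q (orthoFrame p i q)) (orthoFrame p i q))
    Finset.univ F.contMDiff.contMDiffAt fun i _ ↦ ?_).congr ?_
  · have h : ∀ᶠ q in 𝓝 p, SmoothAt E₁ (fun q ↦ q) (orthoFrame p i) q :=
      Filter.mem_of_superset ((chartAt E₁ p).open_source.mem_nhds hp)
        fun q hq ↦ smoothAt_orthoFrame hq i
    exact (smoothNear_secondFF F (h.mono fun q hq ↦ smoothAt_hor hF hq) h).self_of_nhds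
  · filter_upwards [(chartAt E₁ p).open_source.mem_nhds hp] with q hq
    obtain ⟨b, hb⟩ := exists_orthonormalBasis (E₂ := E₁) hq
    simp_rw [← hb]
    exact traceOn_eq_sum (ker F q)ᗮ (secondFFHom F q) b

lemma smoothAt_kerMean (p : M₁) : SmoothAt E₁ (fun q ↦ q) (kerMean F) p := by
  refine ((smoothAt_adj F (smoothAt_traceOn_ker hF p)).const_smul (dimKer F p : ℝ)⁻¹).neg.congr ?_
  filter_upwards [eventually_dimKer_eq hF p] with q hq
  rw [kerMean_eq hF, hq]

lemma smoothAt_rangeMean (p : M₁) : SmoothAt E₁ F (rangeMean F) p := by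
  refine ((smoothAt_traceOn_ker_orthogonal hF p).const_smul (rank F p : ℝ)⁻¹).congr ?_
  filter_upwards [eventually_rank_eq hF p] with q hq
  rw [rangeMean_eq hF, hq]

/-- When `μ` is parallel, the one-form `(∇F_*)(·, μ)` is normal to the image. -/
lemma secondFF_kerMean_mem (hker : KerMeanParallel F) (x : TangentSpace 𝓘(ℝ, E₁) p) :
    secondFF F p x (kerMean F p) ∈ (range F p)ᗮ := by
  have key : ∀ x z : TangentSpace 𝓘(ℝ, E₁) p,
      ⟪secondFF F p x (kerMean F p), d F p z⟫_ℝ + ⟪secondFF F p x z, d F p (kerMean F p)⟫_ℝ = 0 := by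
    intro x z
    have h := inner_secondFF_add hF (smoothAt_kerMean hF p) x z
    have h2 : (fun q ↦ hor F q (kerMean F q)) = kerMean F :=
      funext fun q ↦ hor_eq_self (kerMean_mem hF q)
    rwa [h2, hker p x, inner_zero_left, inner_zero_left, sub_zero] at h
  refine mem_range_orthogonal.2 fun z ↦ ?_
  rw [← d_hor z]
  -- `⟪S x, F_* z⟫ = -⟪(∇F_*)(x, z), F_* μ⟫ = -⟪(∇F_*)(z, x), F_* μ⟫ = ⟪(∇F_*)(z, μ), F_* x⟫`, and
  -- the last term vanishes because `z` and `μ` are horizontal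
  have h1 := key x (hor F p z)
  have h2 := key (hor F p z) x
  have h3 := mem_range_orthogonal.1
    (secondFF_mem_orthogonal hF (hor_mem z) (kerMean_mem hF p)) x
  rw [secondFF_comm F _ x] at h2
  linarith

omit hF in
/-- The Weingarten formula. -/
lemma inner_covAlong_normal {V : ∀ q, TangentSpace 𝓘(ℝ, E₂) (F q)} (hV : SmoothAt E₁ F V p)
    (hn : ∀ q, V q ∈ (range F q)ᗮ) (x z : TangentSpace 𝓘(ℝ, E₁) p) :
    ⟪covAlong F V p x, d F p z⟫_ℝ = -⟪V p, secondFF F p x z⟫_ℝ := by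
  have h1 := mvfderiv_inner hV (smoothAt_d F (smoothAt_ext (mem_chart_source E₁ p) z)) x
  have h2 := mvfderiv_congr (p := p) (f := fun q ↦ ⟪V q, d F q (ext z q)⟫_ℝ) (g := fun _ ↦ (0 : ℝ))
    (.of_forall fun q ↦ mem_range_orthogonal.1 (hn q) _) x
  have h3 : secondFF F p x z = covAlong F (fun q ↦ d F q (ext z q)) p x
    - d F p (leviCivita (ext z) p x) := rfl
  rw [h1, mvfderiv_const] at h2
  simp only [ext_self, zero_apply] at h2
  rw [h3, inner_sub_right, mem_range_orthogonal.1 (hn p)]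
  linarith

/-- The shape operator can be computed with any normal extension, and the direction of
differentiation matters only through its image under `F_*`. -/
lemma shape_eq {V : ∀ q, TangentSpace 𝓘(ℝ, E₂) (F q)} (hV : SmoothAt E₁ F V p)
    (hn : ∀ q, V q ∈ (range F q)ᗮ) (x : TangentSpace 𝓘(ℝ, E₁) p) :
    shape F p (V p) (d F p x) = -tang F p (covAlong F V p x) := by
  have hV' : SmoothAt E₁ F (fun q ↦ nor F q (ext (V p) (F q))) p :=
    smoothAt_nor hF ((smoothAt_ext (mem_chart_source E₂ (F p)) (V p)).comp F.contMDiff.contMDiffAt)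
  unfold shape
  rw [← d_adj hF, ← d_adj hF (covAlong F V p x)]
  congr 2
  refine ext_inner_right ℝ fun z ↦ ?_
  rw [inner_adj, inner_adj, inner_covAlong_normal hV' (fun q ↦ nor_mem _),
    inner_covAlong_normal hV hn, ext_self, nor_eq_self (hn p), adj_d hF]
  -- the direction `x` is replaced by its horizontal part: `(∇F_*)(𝓥 x, z)` is tangential
  conv_rhs => rw [← vert_add_hor (F := F) x, secondFF_add_left, inner_add_right]
  have hv : vert F p x ∈ ker F p := d_vert x
  rw [secondFF_comm F (vert F p x) z, secondFF_eq_neg_d hv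
    (smoothAt_vert hF (smoothAt_ext (mem_chart_source E₁ p) _)), inner_neg_right,
    mem_range_orthogonal.1 (hn p), neg_zero, zero_add]

lemma meanShape_eq (q : M₁) (x : TangentSpace 𝓘(ℝ, E₁) q) :
    meanShape F q x = -adj F q (covAlong F (rangeMean F) q x) := by
  unfold meanShape
  rw [shape_eq hF (smoothAt_rangeMean hF q) (rangeMean_mem hF), map_neg, adj_tang]

lemma smoothAt_meanShape {Y : ∀ q : M₁, TangentSpace 𝓘(ℝ, E₁) q}
    (hY : SmoothAt E₁ (fun q ↦ q) Y p) :
    SmoothAt E₁ (fun q ↦ q) (fun q ↦ meanShape F q (Y q)) p :=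
  (smoothAt_adj F (smoothAt_covAlong (.of_forall (smoothAt_rangeMean hF)) hY)).neg.congr
    (.of_forall fun q ↦ meanShape_eq hF q (Y q))

/-- A parallel `H₂` is differentiated by the shape operator alone. -/
lemma d_meanShape (hrange : RangeMeanParallel F) (q : M₁) (x : TangentSpace 𝓘(ℝ, E₁) q) :
    d F q (meanShape F q x) = -covAlong F (rangeMean F) q x := by
  have h := tang_add_nor (covAlong F (rangeMean F) q x)
  have h2 : nor F q (covAlong F (rangeMean F) q x) = 0 := hrange q x
  rw [h2, add_zero] at h
  rw [meanShape_eq hF, map_neg, d_adj hF, h]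

end

end RiemannianMap

/-! ### The bitension field -/

section Bitension

variable {E₁ : Type*} [NormedAddCommGroup E₁] [NormedSpace ℝ E₁] [FiniteDimensional ℝ E₁]
  {M₁ : Type*} [TopologicalSpace M₁] [ChartedSpace E₁ M₁] [IsManifold 𝓘(ℝ, E₁) ∞ M₁]
  [RiemannianBundle (fun p : M₁ ↦ TangentSpace 𝓘(ℝ, E₁) p)]
  [IsContMDiffRiemannianBundle 𝓘(ℝ, E₁) ∞ E₁ (fun p : M₁ ↦ TangentSpace 𝓘(ℝ, E₁) p)]
  {E₂ : Type*} [NormedAddCommGroup E₂] [NormedSpace ℝ E₂] [FiniteDimensional ℝ E₂]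
  {M₂ : Type*} [TopologicalSpace M₂] [ChartedSpace E₂ M₂] [IsManifold 𝓘(ℝ, E₂) ∞ M₂]
  [RiemannianBundle (fun p : M₂ ↦ TangentSpace 𝓘(ℝ, E₂) p)]
  [IsContMDiffRiemannianBundle 𝓘(ℝ, E₂) ∞ E₂ (fun p : M₂ ↦ TangentSpace 𝓘(ℝ, E₂) p)]
  {F : C^∞⟮𝓘(ℝ, E₁), M₁; 𝓘(ℝ, E₂), M₂⟯} (hF : IsRiemannianMap F)
include hF

/-- The derivative of the tension field, for parallel mean curvature fields. -/
lemma covAlong_tension (hrange : RangeMeanParallel F) (hker : KerMeanParallel F) (q : M₁)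
    (x : TangentSpace 𝓘(ℝ, E₁) q) :
    covAlong F (tension F) q x = -((dimKer F q : ℝ) • secondFF F q x (kerMean F q)
      + (rank F q : ℝ) • d F q (meanShape F q x)) := by
  have h : ∀ᶠ q' in 𝓝 q, tension F q' =
      -((dimKer F q : ℝ) • d F q' (kerMean F q')) + (rank F q : ℝ) • rangeMean F q' := by
    filter_upwards [eventually_dimKer_eq hF q, eventually_rank_eq hF q] with q' h1 h2
    rw [tension_eq hF, h1, h2]
  have hs := smoothAt_d F (smoothAt_kerMean hF q)
  have h2 := secondFF_eq F (smoothAt_kerMean hF q) x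
  rw [hker q x, map_zero, sub_zero] at h2
  rw [covAlong_congr h, covAlong_add (hs.const_smul _).neg ((smoothAt_rangeMean hF q).const_smul _),
    covAlong_neg (hs.const_smul _), covAlong_const_smul _ hs,
    covAlong_const_smul _ (smoothAt_rangeMean hF q), d_meanShape hF hrange, h2, smul_neg, neg_add,
    neg_neg]

/-- The Hessian of the tension field. -/
lemma hessian_tension (hrange : RangeMeanParallel F) (hker : KerMeanParallel F) (p : M₁)
    (x y : TangentSpace 𝓘(ℝ, E₁) p) :
    covAlong F (fun q ↦ covAlong F (tension F) q (ext y q)) p x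
        - covAlong F (tension F) p (leviCivita (ext y) p x) =
      -((dimKer F p : ℝ) • (covAlong F (fun q ↦ secondFF F q (ext y q) (kerMean F q)) p x
          - secondFF F p (leviCivita (ext y) p x) (kerMean F p))
        + (rank F p : ℝ) • (secondFF F p x (meanShape F p y)
          + d F p (leviCivita (fun q ↦ meanShape F q (ext y q)) p x
            - meanShape F p (leviCivita (ext y) p x)))) := by
  have hy := smoothNear_ext y
  have hS : SmoothAt E₁ F (fun q ↦ secondFF F q (ext y q) (kerMean F q)) p :=
    (smoothNear_secondFF F hy (.of_forall (smoothAt_kerMean hF))).self_of_nhds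
  have hT := smoothAt_meanShape hF hy.self_of_nhds
  have h : ∀ᶠ q in 𝓝 p, covAlong F (tension F) q (ext y q) =
      -((dimKer F p : ℝ) • secondFF F q (ext y q) (kerMean F q)
        + (rank F p : ℝ) • d F q (meanShape F q (ext y q))) := by
    filter_upwards [eventually_dimKer_eq hF p, eventually_rank_eq hF p] with q h1 h2
    rw [covAlong_tension hF hrange hker, h1, h2]
  have h2 := secondFF_eq F hT x
  rw [ext_self] at h2
  have hdT := smoothAt_d F hT
  rw [covAlong_congr h, covAlong_neg ((hS.const_smul _).add (hdT.const_smul _)),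
    covAlong_add (hS.const_smul _) (hdT.const_smul _), covAlong_const_smul _ hS,
    covAlong_const_smul _ hdT, covAlong_tension hF hrange hker, h2, map_sub]
  module

/-- The diagonal of `∇S`, where `S = (∇F_*)(·, μ)`, split into its normal and tangential parts. -/
lemma nabla_secondFF_kerMean (hker : KerMeanParallel F) (p : M₁) (x : TangentSpace 𝓘(ℝ, E₁) p) :
    covAlong F (fun q ↦ secondFF F q (ext x q) (kerMean F q)) p x
        - secondFF F p (leviCivita (ext x) p x) (kerMean F p) =
      normalCov F (fun q ↦ secondFF F q (ext x q) (kerMean F q)) p x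
        - nor F p (secondFF F p (leviCivita (ext x) p x) (kerMean F p))
        - shape F p (secondFF F p x (kerMean F p)) (d F p x) := by
  have hS : SmoothAt E₁ F (fun q ↦ secondFF F q (ext x q) (kerMean F q)) p :=
    (smoothNear_secondFF F (smoothNear_ext x) (.of_forall (smoothAt_kerMean hF))).self_of_nhds
  have h := shape_eq hF hS (fun q ↦ secondFF_kerMean_mem hF hker _) x
  simp only [ext_self] at h
  rw [h, nor_eq_self (secondFF_kerMean_mem hF hker _)]
  have h2 := tang_add_nor (covAlong F (fun q ↦ secondFF F q (ext x q) (kerMean F q)) p x)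
  unfold normalCov
  conv_lhs => rw [← h2]
  abel

/-- The curvature term of the bitension field, for a target of constant curvature. -/
lemma trace_curvature_tension {c : ℝ} (hM₂ : IsSpaceForm E₂ M₂ c) (p : M₁) :
    trace (fun x y : TangentSpace 𝓘(ℝ, E₁) p ↦
        curvature (F p) (d F p x) (tension F p) (d F p y)) =
      ((dimKer F p : ℝ) * c * ((rank F p : ℝ) - 1)) • d F p (kerMean F p)
        - ((rank F p : ℝ) ^ 2 * c) • rangeMean F p := by
  set e := stdOrthonormalBasis ℝ (TangentSpace 𝓘(ℝ, E₁) p)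
  have h1 : ∑ i, ⟪tension F p, d F p (e i)⟫_ℝ • d F p (e i) = tang F p (tension F p) := by
    rw [← d_adj hF, ← e.sum_repr' (adj F p (tension F p)), map_sum]
    refine Finset.sum_congr rfl fun i _ ↦ ?_
    rw [map_smul, real_inner_comm (adj F p _), inner_adj]
  have h2 : tang F p (tension F p) = -((dimKer F p : ℝ) • d F p (kerMean F p)) := by
    have hadd : ∀ a b, tang F p (a + b) = tang F p a + tang F p b := map_add _
    rw [tension_eq hF, hadd,
      tang_eq_self (Submodule.neg_mem _ (Submodule.smul_mem _ _ (d_mem_range _))),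
      tang_eq_zero (Submodule.smul_mem _ _ (rangeMean_mem hF p)), add_zero]
  calc trace (fun x y : TangentSpace 𝓘(ℝ, E₁) p ↦
        curvature (F p) (d F p x) (tension F p) (d F p y))
      = ∑ i, curvature (F p) (d F p (e i)) (tension F p) (d F p (e i)) := rfl
    _ = c • (∑ i, ⟪tension F p, d F p (e i)⟫_ℝ • d F p (e i)
          - (∑ i, ⟪d F p (e i), d F p (e i)⟫_ℝ) • tension F p) := by
        rw [Finset.sum_smul, ← Finset.sum_sub_distrib, Finset.smul_sum]
        exact Finset.sum_congr rfl fun i _ ↦ hM₂ _ _ _ _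
    _ = _ := by
        rw [h1, h2, ← rank_eq_sum hF, tension_eq hF]
        module

/-- The bitension field, split into its tangential and its normal part. -/
lemma bitension_eq {c : ℝ} (hM₂ : IsSpaceForm E₂ M₂ c) (hrange : RangeMeanParallel F)
    (hker : KerMeanParallel F) (p : M₁) :
    bitension F p =
      ((dimKer F p : ℝ) • traceShape F p - (rank F p : ℝ) • traceNablaMeanShape F p
        - ((dimKer F p : ℝ) * c * ((rank F p : ℝ) - 1)) • d F p (kerMean F p))
      - ((dimKer F p : ℝ) • traceNormalCovSecondFF F p
        + (rank F p : ℝ) • traceSecondFFMeanShape F p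
        - ((rank F p : ℝ) ^ 2 * c) • rangeMean F p) := by
  have h : -laplacian F (tension F) p =
      (dimKer F p : ℝ) • traceShape F p - (rank F p : ℝ) • traceNablaMeanShape F p
      - ((dimKer F p : ℝ) • traceNormalCovSecondFF F p
        + (rank F p : ℝ) • traceSecondFFMeanShape F p) := by
    unfold laplacian traceShape traceNablaMeanShape traceNormalCovSecondFF traceSecondFFMeanShape
      trace
    rw [neg_neg]
    simp only [Finset.smul_sum, ← Finset.sum_add_distrib, ← Finset.sum_sub_distrib]
    refine Finset.sum_congr rfl fun i _ ↦ ?_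
    rw [hessian_tension hF hrange hker, nabla_secondFF_kerMean hF hker]
    module
  unfold bitension
  rw [h, trace_curvature_tension hF hM₂]
  abel

omit hF in
lemma traceShape_mem (p : M₁) : traceShape F p ∈ range F p := by
  unfold traceShape trace
  exact Submodule.sum_mem _ fun _ _ ↦ Submodule.neg_mem _ (tang_mem _)

omit hF in
lemma traceNablaMeanShape_mem (p : M₁) : traceNablaMeanShape F p ∈ range F p := by
  unfold traceNablaMeanShape trace
  exact Submodule.sum_mem _ fun _ _ ↦ d_mem_range _

omit hF in
lemma traceNormalCovSecondFF_mem (p : M₁) : traceNormalCovSecondFF F p ∈ (range F p)ᗮ := by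
  unfold traceNormalCovSecondFF trace
  exact Submodule.sum_mem _ fun _ _ ↦ Submodule.sub_mem _ (nor_mem _) (nor_mem _)

/-- `*F_* ∘ A_{H₂} ∘ F_*` takes horizontal values and vanishes on vertical vectors, so that only
horizontal vectors enter this trace. -/
lemma traceSecondFFMeanShape_mem (p : M₁) : traceSecondFFMeanShape F p ∈ (range F p)ᗮ := by
  let T : TangentSpace 𝓘(ℝ, E₁) p →ₗ[ℝ] TangentSpace 𝓘(ℝ, E₁) p :=
    { toFun := meanShape F p
      map_add' := fun x y ↦ by
        simp only [meanShape_eq hF, covAlong_apply_add, map_add, neg_add]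
      map_smul' := fun c x ↦ by
        simp only [meanShape_eq hF, covAlong_apply_smul, map_smul, smul_neg, RingHom.id_apply] }
  have hT : ∀ x, hor F p (T x) = T x := fun x ↦ hor_adj _
  have hT0 : ∀ x ∈ ker F p, T x = 0 := fun x hx ↦ by
    have hx0 : d F p x = 0 := hx
    have h := shape_eq hF (smoothAt_rangeMean hF p) (rangeMean_mem hF)
      (0 : TangentSpace 𝓘(ℝ, E₁) p)
    have h0 := covAlong_apply_smul (rangeMean F) 0 (0 : TangentSpace 𝓘(ℝ, E₁) p)
    rw [zero_smul, zero_smul] at h0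
    have ht0 : tang F p 0 = 0 := map_zero _
    rw [map_zero, h0, ht0, neg_zero] at h
    change adj F p (shape F p (rangeMean F p) (d F p x)) = 0
    rw [hx0, h, map_zero]
  have h := traceOn_add_traceOn_orthogonal (ker F p) ((secondFFHom F p).compl₂ T)
  have e : traceSecondFFMeanShape F p = trace fun x y ↦ (secondFFHom F p).compl₂ T x y := rfl
  rw [e, ← h]
  refine Submodule.add_mem _ (traceOn_mem fun x _ y hy ↦ ?_) (traceOn_mem fun x hx y _ ↦ ?_)
  · rw [LinearMap.compl₂_apply, hT0 y hy, map_zero]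
    exact Submodule.zero_mem _
  · refine secondFF_mem_orthogonal hF hx ?_
    rw [← hT]
    exact hor_mem _

lemma bitension_eq_zero_iff {c : ℝ} (hM₂ : IsSpaceForm E₂ M₂ c) (hrange : RangeMeanParallel F)
    (hker : KerMeanParallel F) (p : M₁) :
    bitension F p = 0 ↔
      (dimKer F p : ℝ) • traceShape F p - (rank F p : ℝ) • traceNablaMeanShape F p
        - ((dimKer F p : ℝ) * c * ((rank F p : ℝ) - 1)) • d F p (kerMean F p) = 0 ∧
      (dimKer F p : ℝ) • traceNormalCovSecondFF F p
        + (rank F p : ℝ) • traceSecondFFMeanShape F p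
        - ((rank F p : ℝ) ^ 2 * c) • rangeMean F p = 0 := by
  rw [bitension_eq hF hM₂ hrange hker, sub_eq_zero]
  refine ⟨fun h ↦ ?_, fun h ↦ h.1.trans h.2.symm⟩
  have ha : (dimKer F p : ℝ) • traceShape F p - (rank F p : ℝ) • traceNablaMeanShape F p
      - ((dimKer F p : ℝ) * c * ((rank F p : ℝ) - 1)) • d F p (kerMean F p) ∈ range F p :=
    Submodule.sub_mem _ (Submodule.sub_mem _ (Submodule.smul_mem _ _ (traceShape_mem p))
      (Submodule.smul_mem _ _ (traceNablaMeanShape_mem p)))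
      (Submodule.smul_mem _ _ (d_mem_range _))
  have hb : (dimKer F p : ℝ) • traceNormalCovSecondFF F p
      + (rank F p : ℝ) • traceSecondFFMeanShape F p
      - ((rank F p : ℝ) ^ 2 * c) • rangeMean F p ∈ (range F p)ᗮ :=
    Submodule.sub_mem _ (Submodule.add_mem _
      (Submodule.smul_mem _ _ (traceNormalCovSecondFF_mem p))
      (Submodule.smul_mem _ _ (traceSecondFFMeanShape_mem hF p)))
      (Submodule.smul_mem _ _ (rangeMean_mem hF p))
  have h0 := inner_self_eq_zero (𝕜 := ℝ).1 ((range F p).inner_right_of_mem_orthogonal ha (h ▸ hb))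
  exact ⟨h0, h ▸ h0⟩

end Bitension

end RiemMap

end

theorem corollary4p1
    {E₁ : Type*} [NormedAddCommGroup E₁] [NormedSpace ℝ E₁] [FiniteDimensional ℝ E₁]
    {M₁ : Type*} [TopologicalSpace M₁] [T2Space M₁] [SecondCountableTopology M₁]
    [ChartedSpace E₁ M₁] [IsManifold 𝓘(ℝ, E₁) ∞ M₁]
    [RiemannianBundle (fun p : M₁ ↦ TangentSpace 𝓘(ℝ, E₁) p)]
    [IsContMDiffRiemannianBundle 𝓘(ℝ, E₁) ∞ E₁ (fun p : M₁ ↦ TangentSpace 𝓘(ℝ, E₁) p)]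
    {E₂ : Type*} [NormedAddCommGroup E₂] [NormedSpace ℝ E₂] [FiniteDimensional ℝ E₂]
    {M₂ : Type*} [TopologicalSpace M₂] [T2Space M₂] [SecondCountableTopology M₂]
    [ChartedSpace E₂ M₂] [IsManifold 𝓘(ℝ, E₂) ∞ M₂]
    [RiemannianBundle (fun p : M₂ ↦ TangentSpace 𝓘(ℝ, E₂) p)]
    [IsContMDiffRiemannianBundle 𝓘(ℝ, E₂) ∞ E₂ (fun p : M₂ ↦ TangentSpace 𝓘(ℝ, E₂) p)]
    (c : ℝ) (hM₂ : RiemMap.IsSpaceForm E₂ M₂ c)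
    (F : C^∞⟮𝓘(ℝ, E₁), M₁; 𝓘(ℝ, E₂), M₂⟯) (hF : RiemMap.IsRiemannianMap F)
    (hrange : RiemMap.RangeMeanParallel F) (hker : RiemMap.KerMeanParallel F) :
    RiemMap.IsBiharmonic F ↔
      (∀ p : M₁,
        (RiemMap.dimKer F p : ℝ) • RiemMap.traceShape F p
          - (RiemMap.rank F p : ℝ) • RiemMap.traceNablaMeanShape F p
          - ((RiemMap.dimKer F p : ℝ) * c * ((RiemMap.rank F p : ℝ) - 1)) •
              RiemMap.d F p (RiemMap.kerMean F p) = 0) ∧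
      (∀ p : M₁,
        (RiemMap.dimKer F p : ℝ) • RiemMap.traceNormalCovSecondFF F p
          + (RiemMap.rank F p : ℝ) • RiemMap.traceSecondFFMeanShape F p
          - ((RiemMap.rank F p : ℝ) ^ 2 * c) • RiemMap.rangeMean F p = 0) :=
  (forall_congr' fun p ↦ RiemMap.bitension_eq_zero_iff hF hM₂ hrange hker p).trans forall_and
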